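/- Let $(b_j)_{j\ge 0}$ be real numbers with $b_j\ge 0$ for $j\ne 1$ and $0<-b_1=\sum_{j\ne 1}b_j<\infty$, and put $B(y)=\sum_{j\ge 0}b_jy^j$. Let $\{X(t);\,t\ge 0\}$ be a regular Markov branching process with $X(0)=1$, that is, a continuous-time Markov chain on $\{0,1,2,\dots\}$ with right-continuous step paths having finitely many jumps in bounded time, whose honest transition function $P(t)=(p_{ij}(t))$ satisfies the forward equation $p_{ij}'(t)=\sum_k p_{ik}(t)q_{kj}$, where $q_{ij}=i\,b_{j-i+1}$ if $i\ge 1$, $j\ge i-1$, and $q_{ij}=0$ otherwise. Fix an integer $m>1$, and let $Y_m(t)$ be the $(m-1)$-range up-crossing number until time $t$, that is, the number of times $s\in(0,t]$ with $X(s)-X(s-)=m-1$. Then for all $u,v\in[0,1]$ the initial value problem $$\frac{\partial y}{\partial t}=B(y)-b_m(1-v)y^m\quad(t\ge 0),\qquad y|_{t=0}=u,$$ has a unique solution $y=G(t,u,v)$ on $[0,\infty)$ (among functions with values where the series $B$ converges absolutely), and the probability generating function of $Y_m(t)$ is $$E\big[v^{Y_m(t)}\,\big|\,X(0)=1\big]=G(t,1,v),\qquad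 v\in[0,1],\ t\ge 0.$$ -/

import Mathlib

open Set Filter Topology MeasureTheory
open scoped NNReal

namespace BranchingCrossing

/-- The sequence `b` of branching rates: `b j ≥ 0` for `j ≠ 1` and
`0 < - b 1 = ∑_{j ≠ 1} b j < ∞`. -/
structure IsBranchingRates (b : ℕ → ℝ) : Prop where
  nonneg : ∀ j, j ≠ 1 → 0 ≤ b j
  pos : 0 < -b 1
  hasSum : HasSum (fun j : {j : ℕ // j ≠ 1} => b j) (-b 1)

/-- The branching `Q`-matrix: `q i j = i * b (j - i + 1)` if `i ≥ 1` and `j ≥ i - 1`,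
and `0` otherwise. -/
noncomputable def branchingQ (b : ℕ → ℝ) (i j : ℕ) : ℝ :=
  if 1 ≤ i ∧ i ≤ j + 1 then (i : ℝ) * b (j + 1 - i) else 0

/-- Standard honest transition functions `p t i j` on `ℕ`; only times `t ≥ 0` matter. -/
structure IsTransitionFunction (p : ℝ → ℕ → ℕ → ℝ) : Prop where
  nonneg : ∀ t, 0 ≤ t → ∀ i j, 0 ≤ p t i j
  hasSum_one : ∀ t, 0 ≤ t → ∀ i, HasSum (fun j => p t i j) 1
  zero : ∀ i j, p 0 i j = if i = j then 1 else 0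
  chapman_kolmogorov : ∀ s t, 0 ≤ s → 0 ≤ t → ∀ i j,
    HasSum (fun k => p s i k * p t k j) (p (s + t) i j)
  standard : ∀ i, Tendsto (fun t => p t i i) (𝓝[>] 0) (𝓝 1)

/-- Kolmogorov's forward equation `p'_{ij}(t) = ∑_k p_{ik}(t) q_{kj}` for `t ≥ 0`
(one-sided derivative at `t = 0`). For each `j` only finitely many terms of the sum
are non-zero, since `q k j = 0` for `k > j + 1`. -/
def ForwardEquation (b : ℕ → ℝ) (p : ℝ → ℕ → ℕ → ℝ) : Prop :=
  ∀ i j : ℕ, ∀ t : ℝ, 0 ≤ t →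
    HasDerivWithinAt (fun s => p s i j) (∑' k, p t i k * branchingQ b k j) (Ici 0) t

/-- A step path with values in the discrete space `ℕ`: right-continuous with left limits,
so with finitely many jumps in bounded time. -/
def IsStepPath (x : ℝ≥0 → ℕ) : Prop :=
  (∀ t, ∀ᶠ s in 𝓝[>] t, x s = x t) ∧
    ∀ t, 0 < t → ∃ i, ∀ᶠ s in 𝓝[<] t, x s = i

/-- `X` is a (regular) Markov branching process with branching rates `b` under `μ`: a
continuous-time Markov chain on `ℕ` with step paths, whose transition function is honest and
satisfies the forward equation of the branching `Q`-matrix. -/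
structure IsMarkovBranchingProcess {Ω : Type*} [MeasurableSpace Ω] (b : ℕ → ℝ)
    (μ : Measure Ω) (X : ℝ≥0 → Ω → ℕ) : Prop where
  measurable : ∀ t, Measurable (X t)
  step_paths : ∀ᵐ ω ∂μ, IsStepPath (fun t => X t ω)
  markov : ∃ p : ℝ → ℕ → ℕ → ℝ, IsTransitionFunction p ∧ ForwardEquation b p ∧
    ∀ (n : ℕ) (t : ℕ → ℝ≥0) (x : ℕ → ℕ), Monotone t →
      μ.real {ω | ∀ k ≤ n + 1, X (t k) ω = x k} =
        μ.real {ω | ∀ k ≤ n, X (t k) ω = x k} *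
          p ((t (n + 1) : ℝ) - (t n : ℝ)) (x n) (x (n + 1))

/-- The times `s ∈ (0, t]` at which the path `x` jumps by exactly `m - 1`, that is, from some
`i` to `j` with `j - i + 1 = m`: a particle splits into `m` new ones. -/
def crossingTimes (x : ℝ≥0 → ℕ) (m : ℕ) (t : ℝ≥0) : Set ℝ≥0 :=
  {s | 0 < s ∧ s ≤ t ∧ ∃ i, (∀ᶠ r in 𝓝[<] s, x r = i) ∧ x s + 1 = i + m}

/-- The `(m - 1)`-range crossing number of the path `x` until time `t`. For step paths and
`m ≠ 1` the set that is counted is finite, see `crossingTimes_finite`. -/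
noncomputable def crossingNumber (x : ℝ≥0 → ℕ) (m : ℕ) (t : ℝ≥0) : ℕ :=
  (crossingTimes x m t).ncard

theorem crossingTimes_finite {x : ℝ≥0 → ℕ} (hx : IsStepPath x) {m : ℕ} (hm : m ≠ 1)
    (t : ℝ≥0) : (crossingTimes x m t).Finite := by
  -- near every `a`, the path is constant on each side of `a`, so only `a` can be counted
  have key : ∀ {s : ℝ≥0} {c : ℕ}, (∀ᶠ r in 𝓝 s, x r = c) → s ∉ crossingTimes x m t := by
    rintro s c h ⟨h0, -, i, hi, hj⟩
    have : (𝓝[<] s).NeBot := nhdsLT_neBot_of_exists_lt ⟨0, h0⟩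
    obtain ⟨r, hr1, hr2⟩ := (hi.and (h.filter_mono nhdsWithin_le_nhds)).exists
    have := h.self_of_nhds
    omega
  have loc : ∀ a, ∀ᶠ s in 𝓝[≠] a, s ∉ crossingTimes x m t := by
    intro a
    rw [← nhdsLT_sup_nhdsGT, eventually_sup]
    constructor
    · rcases eq_or_lt_of_le (zero_le (a := a)) with h | h
      · subst h
        simp
      · obtain ⟨i, hi⟩ := hx.2 a h
        filter_upwards [eventually_eventually_nhdsWithin.2 hi, self_mem_nhdsWithin] with s hs hsa
        rw [isOpen_Iio.nhdsWithin_eq hsa] at hs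
        exact key hs
    · filter_upwards [eventually_eventually_nhdsWithin.2 (hx.1 a), self_mem_nhdsWithin]
        with s hs hsa
      rw [isOpen_Ioi.nhdsWithin_eq hsa] at hs
      exact key hs
  by_contra hinf
  have hsub : crossingTimes x m t ⊆ Icc 0 t := fun s hs => ⟨hs.1.le, hs.2.1⟩
  obtain ⟨a, -, ha⟩ := Set.Infinite.exists_accPt_of_subset_isCompact hinf isCompact_Icc hsub
  rw [accPt_iff_frequently_nhdsNE] at ha
  exact ha (loc a)

/-- The generating function `B(u) = ∑_j b_j u^j` of the rates. -/
noncomputable def rateGF (b : ℕ → ℝ) (u : ℝ) : ℝ := ∑' j, b j * u ^ j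

/-- `y : [0, ∞) → ℝ` solves `y' = B(y) - b_m (1 - v) y^m`, `y(0) = u`, with values where
the series `B` converges (one-sided derivative at `t = 0`). -/
structure IsSolution (b : ℕ → ℝ) (m : ℕ) (u v : ℝ) (y : ℝ → ℝ) : Prop where
  init : y 0 = u
  summable : ∀ t, 0 ≤ t → Summable (fun j => b j * y t ^ j)
  deriv : ∀ t, 0 ≤ t →
    HasDerivWithinAt y (rateGF b (y t) - b m * (1 - v) * y t ^ m) (Ici 0) t

end BranchingCrossing

namespace BranchingCrossing

/-! Write f(x) = B(x) - b_m(1-v)x^m, and let w_ij be v if j - i = m - 1 and 1 otherwise. The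
branching form of Q gives ∑_j q_ij w_ij x^j = i x^(i-1) f(x)
(`hasSum_branchingQ_mul_crossingWeight`), which is the derivative of y^i along y' = f(y). So for a
solution y on [0,T] with y(0) = u, the process y(T-t)^X(t) v^(Y_m(t)) should have constant
expectation: y(T) at t = 0, since X(0) = 1, and E[u^X(T) v^(Y_m(T))] at t = T.

For u < 1 this is proved on grids of mesh h = T/n. Over one step the expectation changes by at most
C h², with C independent of the state i (`SolvesOn.exists_abs_tsum_sub_le`); the n steps cost
O(1/n). For almost every path the increments of size m - 1 along a fine grid are exactly the
crossings (`IsStepPath.exists_gridCount_eq`). The solution y comes from Picard-Lindelöf: f is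
Lipschitz on [0,ρ] for ρ < 1, and f(x) ≤ b_0(1-x) keeps y away from 1.

At u = 1, f may fail to be Lipschitz. Existence follows from u ↑ 1 in the integral equation. For
uniqueness, a solution from 1 cannot cross those from u < 1, so it dominates their limit. If f(1) <
0, it drops below 1 at once and is bounded above by restarting it there. If f(1) = 0, the comparison
with v = 1, where the generating function is identically 1, forces y = 1. -/

/-! ### Power series estimates for the right-hand side. -/

/-- The right-hand side `B(x) - b_m (1 - v) x^m` of the differential equation. -/
noncomputable def crossingField (b : ℕ → ℝ) (m : ℕ) (v x : ℝ) : ℝ :=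
  rateGF b x - b m * (1 - v) * x ^ m

theorem summable_natCast_mul_pow_pred {ρ : ℝ} (h0 : 0 ≤ ρ) (h1 : ρ < 1) (k : ℕ) :
    Summable (fun j : ℕ => ((j : ℝ) + 2) ^ k * j * ρ ^ (j - 1)) := by
  rw [← summable_nat_add_iff 1]
  -- After the index shift the terms are at most (j+3)^(k+1) ρ^j. The ratio (1+ρ)/2 lies in (ρ,1) or
  -- equals 1/2 at ρ = 0, so it dominates ρ and can be divided by.
  have h := (summable_nat_add_iff 3).2
    (summable_pow_mul_geometric_of_norm_lt_one (R := ℝ) (k + 1) (r := (1 + ρ) / 2)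
      (by rw [Real.norm_of_nonneg (by positivity)]; linarith))
  have hρ : 0 < ((1 + ρ) / 2) ^ 3 := by positivity
  refine Summable.of_nonneg_of_le (fun j => by positivity) (fun j => ?_)
    (h.mul_left (((1 + ρ) / 2) ^ 3)⁻¹)
  rw [Nat.add_sub_cancel, pow_add ((1 + ρ) / 2) j 3, mul_comm (((1 + ρ) / 2) ^ j), ← mul_assoc,
    ← mul_assoc, mul_comm _ (((1 + ρ) / 2) ^ 3), ← mul_assoc, mul_inv_cancel₀ hρ.ne', one_mul]
  push_cast
  have h3 : ρ ^ j ≤ ((1 + ρ) / 2) ^ j := pow_le_pow_left₀ h0 (by linarith) j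
  have h4 : ((j : ℝ) + 1 + 2) ^ k * (j + 1) ≤ ((j : ℝ) + 3) ^ (k + 1) := by
    rw [pow_succ, show (j : ℝ) + 1 + 2 = j + 3 by ring]
    gcongr
    norm_num
  gcongr

/-- Termwise, |x^j - y^j| ≤ j ρ^(j-1) |x - y|. The majorant `A` is kept separate from `c` so that
one constant can serve a whole family of series. -/
theorem abs_tsum_mul_pow_sub_le {c A : ℕ → ℝ} {ρ x y : ℝ} (hA : ∀ j, |c j| ≤ A j)
    (hs : Summable (fun j => A j * j * ρ ^ (j - 1))) (hx : |x| ≤ ρ) (hy : |y| ≤ ρ)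
    (hxs : Summable (fun j => c j * x ^ j)) (hys : Summable (fun j => c j * y ^ j)) :
    |∑' j, c j * x ^ j - ∑' j, c j * y ^ j| ≤ (∑' j, A j * j * ρ ^ (j - 1)) * |x - y| := by
  rw [← hxs.tsum_sub hys, ← tsum_mul_right, ← Real.norm_eq_abs]
  refine tsum_of_norm_bounded (hs.mul_right _).hasSum (fun j => ?_)
  rw [Real.norm_eq_abs, ← mul_sub, abs_mul]
  have h0 : 0 ≤ ρ := (abs_nonneg x).trans hx
  calc |c j| * |x ^ j - y ^ j| ≤ A j * (|x - y| * j * ρ ^ (j - 1)) := by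
        refine mul_le_mul (hA j) ((abs_pow_sub_pow_le x y j).trans ?_) (abs_nonneg _)
          ((abs_nonneg _).trans (hA j))
        gcongr
        exact max_le hx hy
    _ = A j * j * ρ ^ (j - 1) * |x - y| := by ring

/-- The terms at R are bounded, so |c_j| ≤ D R^(-j), and the differentiated series converges
geometrically for ρ < R. R may exceed 1, which is needed to exclude solutions above 1. -/
theorem exists_lipschitz_tsum_mul_pow {c : ℕ → ℝ} {R ρ : ℝ} (h0 : 0 ≤ ρ) (h1 : ρ < R)
    (hc : Summable (fun j => c j * R ^ j)) :
    ∃ K, 0 ≤ K ∧ ∀ x y, |x| ≤ ρ → |y| ≤ ρ →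
      |∑' j, c j * x ^ j - ∑' j, c j * y ^ j| ≤ K * |x - y| := by
  have hR : 0 < R := h0.trans_lt h1
  obtain ⟨D, hD⟩ := hc.tendsto_atTop_zero.abs.bddAbove_range
  have hD' : ∀ j, |c j| ≤ D * (R⁻¹) ^ j := by
    intro j
    have := hD (mem_range_self j)
    simp only [abs_mul, abs_pow, abs_of_pos hR] at this
    rw [inv_pow, ← div_eq_mul_inv, le_div_iff₀ (by positivity)]
    exact this
  have hD0 : 0 ≤ D := (abs_nonneg _).trans ((hD' 0).trans (by simp))
  have hsum : Summable (fun j : ℕ => D * (R⁻¹) ^ j * j * ρ ^ (j - 1)) := by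
    refine ((summable_natCast_mul_pow_pred (ρ := ρ / R) (by positivity)
      ((div_lt_one hR).2 h1) 0).mul_left (D * R⁻¹)).congr (fun j => ?_)
    rcases j with _ | j
    · simp
    · rw [Nat.add_sub_cancel, div_pow, pow_succ, inv_pow]
      field_simp
  have hsx : ∀ x, |x| ≤ ρ → Summable (fun j => c j * x ^ j) := by
    intro x hx
    refine Summable.of_norm_bounded (g := fun j => D * (|x| / R) ^ j)
      ((summable_geometric_of_lt_one (by positivity)
        ((div_lt_one hR).2 (hx.trans_lt h1))).mul_left D) (fun j => ?_)
    rw [Real.norm_eq_abs, abs_mul, abs_pow, div_eq_mul_inv, mul_pow, mul_comm (|x| ^ j),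
      ← mul_assoc]
    gcongr
    exact hD' j
  exact ⟨_, tsum_nonneg (fun j => by positivity), fun x y hx hy =>
    abs_tsum_mul_pow_sub_le hD' hsum hx hy (hsx x hx) (hsx y hy)⟩

theorem crossingField_zero {b : ℕ → ℝ} {m : ℕ} (hm : 1 < m) (v : ℝ) :
    crossingField b m v 0 = b 0 := by
  have : rateGF b 0 = b 0 := by
    rw [rateGF, tsum_eq_single 0 (fun j hj => by simp [hj])]
    simp
  rw [crossingField, this, zero_pow (by omega)]
  ring

theorem exists_lipschitz_crossingField {b : ℕ → ℝ} {R ρ : ℝ} (h0 : 0 ≤ ρ) (h1 : ρ < R)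
    (hc : Summable (fun j => b j * R ^ j)) (m : ℕ) (v : ℝ) :
    ∃ K, 0 ≤ K ∧ ∀ x y, |x| ≤ ρ → |y| ≤ ρ →
      |crossingField b m v x - crossingField b m v y| ≤ K * |x - y| := by
  obtain ⟨K, hK, h⟩ := exists_lipschitz_tsum_mul_pow h0 h1 hc
  refine ⟨K + |b m * (1 - v)| * (m * ρ ^ (m - 1)), by positivity, fun x y hx hy => ?_⟩
  have h2 : |x ^ m - y ^ m| ≤ m * ρ ^ (m - 1) * |x - y| := by
    refine (abs_pow_sub_pow_le x y m).trans ?_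
    rw [mul_assoc, mul_comm]
    gcongr
    exact max_le hx hy
  calc |crossingField b m v x - crossingField b m v y|
      = |(rateGF b x - rateGF b y) - b m * (1 - v) * (x ^ m - y ^ m)| := by
        rw [crossingField, crossingField]; congr 1; ring
    _ ≤ |rateGF b x - rateGF b y| + |b m * (1 - v) * (x ^ m - y ^ m)| := abs_sub _ _
    _ ≤ K * |x - y| + |b m * (1 - v)| * (m * ρ ^ (m - 1) * |x - y|) := by
        rw [abs_mul]
        gcongr
        exact h x y hx hy
    _ = _ := by ring

namespace IsBranchingRates

theorem hasSum_zero {b : ℕ → ℝ} (hb : IsBranchingRates b) : HasSum b 0 := by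
  have h1 : HasSum (fun j : {j : ℕ // j ∈ ({1} : Set ℕ)} => b j) (b 1) := by
    simpa using hasSum_unique (fun j : ({1} : Set ℕ) => b j)
  have h2 : HasSum (fun j : {j : ℕ // j ∈ ({1} : Set ℕ)ᶜ} => b j) (-b 1) := hb.hasSum
  have := h1.add_compl h2
  simpa using this

theorem summable_abs {b : ℕ → ℝ} (hb : IsBranchingRates b) :
    Summable (fun j => |b j|) :=
  hb.hasSum_zero.summable.abs

theorem summable_mul_pow {b : ℕ → ℝ} (hb : IsBranchingRates b) {x : ℝ} (hx : |x| ≤ 1) :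
    Summable (fun j => b j * x ^ j) := by
  refine Summable.of_norm_bounded hb.summable_abs (fun j => ?_)
  rw [Real.norm_eq_abs, abs_mul, abs_pow]
  exact mul_le_of_le_one_right (abs_nonneg _) (pow_le_one₀ (abs_nonneg _) hx)

theorem continuousOn_crossingField {b : ℕ → ℝ} (hb : IsBranchingRates b) (m : ℕ) (v : ℝ) :
    ContinuousOn (crossingField b m v) (Icc 0 1) := by
  refine ContinuousOn.sub (continuousOn_tsum (fun j => by fun_prop) hb.summable_abs ?_)
    (by fun_prop)
  intro j x hx
  rw [Real.norm_eq_abs, abs_mul, abs_pow, abs_of_nonneg hx.1]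
  exact mul_le_of_le_one_right (abs_nonneg _) (pow_le_one₀ hx.1 hx.2)

theorem crossingField_one {b : ℕ → ℝ} (hb : IsBranchingRates b) (m : ℕ) (v : ℝ) :
    crossingField b m v 1 = -(b m * (1 - v)) := by
  simp [crossingField, rateGF, hb.hasSum_zero.tsum_eq]

/-- As ∑ b_j = 0, B(x) = ∑ b_j (x^j - x); the term j = 1 vanishes and those with j ≥ 2 are
nonpositive, leaving j = 0. -/
theorem rateGF_le {b : ℕ → ℝ} (hb : IsBranchingRates b) {x : ℝ} (hx : x ∈ Icc (0 : ℝ) 1) :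
    rateGF b x ≤ b 0 * (1 - x) := by
  have h1 : HasSum (fun j => b j * x ^ j - b j * x) (rateGF b x - 0 * x) :=
    (hb.summable_mul_pow (by rw [abs_of_nonneg hx.1]; exact hx.2)).hasSum.sub
      (hb.hasSum_zero.mul_right x)
  have h2 : HasSum (fun j => if j = 0 then b 0 * (1 - x) else 0) (b 0 * (1 - x)) :=
    hasSum_ite_eq 0 _
  have := hasSum_le (fun j => ?_) h1 h2
  · simpa using this
  rcases j with _ | _ | j
  · simp; linarith
  · simp
  · have h3 := hb.nonneg (j + 2) (by omega)
    have h4 : x ^ (j + 2) ≤ x := pow_le_of_le_one hx.1 hx.2 (by omega)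
    simp only [Nat.add_eq_zero_iff, one_ne_zero, and_false, if_false]
    nlinarith

theorem crossingField_le {b : ℕ → ℝ} (hb : IsBranchingRates b) {m : ℕ} (hm : 1 < m)
    {v x : ℝ} (hv : v ∈ Icc (0 : ℝ) 1) (hx : x ∈ Icc (0 : ℝ) 1) :
    crossingField b m v x ≤ b 0 * (1 - x) := by
  have h1 := hb.rateGF_le hx
  have h2 : 0 ≤ b m * (1 - v) * x ^ m :=
    mul_nonneg (mul_nonneg (hb.nonneg m (by omega)) (by linarith [hv.2])) (pow_nonneg hx.1 m)
  rw [crossingField]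
  linarith

theorem exists_lipschitzOnWith_crossingField {b : ℕ → ℝ} (hb : IsBranchingRates b)
    {ρ : ℝ} (h0 : 0 ≤ ρ) (h1 : ρ < 1) (m : ℕ) (v : ℝ) :
    ∃ K : ℝ≥0, LipschitzOnWith K (crossingField b m v) (Icc 0 ρ) := by
  obtain ⟨K, hK, h⟩ := exists_lipschitz_crossingField h0 h1
    (hb.summable_mul_pow (by simp)) m v
  refine ⟨⟨K, hK⟩, LipschitzOnWith.of_dist_le_mul fun x hx y hy => ?_⟩
  rw [Real.dist_eq, Real.dist_eq]
  exact h x y (abs_le.2 ⟨by linarith [hx.1], hx.2⟩) (abs_le.2 ⟨by linarith [hy.1], hy.2⟩)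

end IsBranchingRates

/-! ### Comparison, uniqueness and existence for the autonomous equation. -/

/-- `y` is a solution of the autonomous equation `y' = f(y)` on `[0, T]`. -/
structure SolvesOn (f : ℝ → ℝ) (T : ℝ) (y : ℝ → ℝ) : Prop where
  continuousOn : ContinuousOn y (Icc 0 T)
  deriv : ∀ t ∈ Ico 0 T, HasDerivWithinAt y (f (y t)) (Ici t) t

theorem SolvesOn.shift {f : ℝ → ℝ} {T : ℝ} {y : ℝ → ℝ} (h : SolvesOn f T y) {s : ℝ}
    (hs : 0 ≤ s) : SolvesOn f (T - s) (fun t => y (t + s)) := by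
  constructor
  · exact h.continuousOn.comp (by fun_prop)
      (fun t ht => ⟨by linarith [ht.1], by linarith [ht.2]⟩)
  · intro t ht
    have h1 := h.deriv (t + s) ⟨by linarith [ht.1], by linarith [ht.2]⟩
    have h2 : HasDerivWithinAt (fun t : ℝ => t + s) 1 (Ici t) t :=
      ((hasDerivAt_id t).add_const s).hasDerivWithinAt
    simpa [Function.comp_def] using h1.scomp t h2 (fun x hx => by
      simp only [mem_Ici] at hx ⊢; linarith)

theorem SolvesOn.mono {f : ℝ → ℝ} {T T' : ℝ} {y : ℝ → ℝ} (h : SolvesOn f T y) (hT : T' ≤ T) :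
    SolvesOn f T' y :=
  ⟨h.continuousOn.mono (Icc_subset_Icc_right hT),
    fun t ht => h.deriv t ⟨ht.1, ht.2.trans_le hT⟩⟩

/-- Barrier argument: ε exp((K+1)(s-T)) grows strictly faster than y may where they touch. It stays
in (0,ε] with ε < δ, so the bound on y' is needed only for small positive values. -/
theorem nonpos_of_deriv_right_le {y y' : ℝ → ℝ} {T K δ : ℝ} (hc : ContinuousOn y (Icc 0 T))
    (hd : ∀ t ∈ Ico 0 T, HasDerivWithinAt y (y' t) (Ici t) t) (h0 : y 0 ≤ 0) (hδ : 0 < δ)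
    (hK : 0 ≤ K) (h : ∀ t ∈ Ico 0 T, 0 < y t → y t < δ → y' t ≤ K * y t) :
    ∀ t ∈ Icc 0 T, y t ≤ 0 := by
  intro t ht
  by_contra! hpos
  obtain ⟨ε, hε, hε1, hε2⟩ : ∃ ε > 0, ε < δ ∧ ε < y t :=
    ⟨min δ (y t) / 2, by positivity, by linarith [min_le_left δ (y t), lt_min hδ hpos],
      by linarith [min_le_right δ (y t), lt_min hδ hpos]⟩
  have key := image_le_of_deriv_right_lt_deriv_boundary
    (B := fun s => ε * Real.exp ((K + 1) * (s - T)))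
    (B' := fun s => (K + 1) * (ε * Real.exp ((K + 1) * (s - T)))) hc hd
    (h0.trans (by positivity)) (fun s => ?_) (fun s hs heq => ?_) ht
  · have : Real.exp ((K + 1) * (t - T)) ≤ 1 :=
      Real.exp_le_one_iff.2 (mul_nonpos_of_nonneg_of_nonpos (by linarith) (by linarith [ht.2]))
    nlinarith
  · have h1 : HasDerivAt (fun s => (K + 1) * (s - T)) (K + 1) s := by
      simpa using ((hasDerivAt_id s).sub_const T).const_mul (K + 1)
    exact (h1.exp.const_mul ε).congr_deriv (by ring)
  · have hp : 0 < ε * Real.exp ((K + 1) * (s - T)) := by positivity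
    have h1 : Real.exp ((K + 1) * (s - T)) ≤ 1 :=
      Real.exp_le_one_iff.2 (mul_nonpos_of_nonneg_of_nonpos (by linarith) (by linarith [hs.2]))
    have h2 := h s hs (by rw [heq]; exact hp) (by rw [heq]; nlinarith)
    rw [heq] at h2
    linarith

/-- The rate a + 1 instead of a makes the barrier's derivative strictly larger at a contact. Asking
for the bound only at contacts lets it apply to a truncated field. -/
theorem le_one_sub_exp_of_deriv_right_le {y y' : ℝ → ℝ} {T a u : ℝ}
    (hc : ContinuousOn y (Icc 0 T)) (hd : ∀ t ∈ Ico 0 T, HasDerivWithinAt y (y' t) (Ici t) t)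
    (h0 : y 0 ≤ u) (hu : u < 1)
    (h : ∀ t ∈ Ico 0 T, y t = 1 - (1 - u) * Real.exp (-(a + 1) * t) → y' t ≤ a * (1 - y t)) :
    ∀ t ∈ Icc 0 T, y t ≤ 1 - (1 - u) * Real.exp (-(a + 1) * t) := by
  intro t ht
  refine image_le_of_deriv_right_lt_deriv_boundary
    (B := fun s => 1 - (1 - u) * Real.exp (-(a + 1) * s))
    (B' := fun s => (a + 1) * ((1 - u) * Real.exp (-(a + 1) * s))) hc hd
    (by simpa using h0) (fun s => ?_) (fun s hs heq => ?_) ht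
  · have h1 : HasDerivAt (fun s => -(a + 1) * s) (-(a + 1)) s := by
      simpa using (hasDerivAt_id s).const_mul (-(a + 1))
    exact ((h1.exp.const_mul (1 - u)).const_sub 1).congr_deriv (by ring)
  · have h1 := h s hs heq
    have h2 : 0 < (1 - u) * Real.exp (-(a + 1) * s) := mul_pos (by linarith) (Real.exp_pos _)
    rw [heq] at h1
    linarith

theorem one_sub_mul_exp_lt_one {u a t : ℝ} (hu : u < 1) :
    1 - (1 - u) * Real.exp (-(a + 1) * t) < 1 := by
  have : 0 < (1 - u) * Real.exp (-(a + 1) * t) := mul_pos (by linarith) (Real.exp_pos _)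
  linarith

theorem one_sub_mul_exp_mono {u a s t : ℝ} (hu : u < 1) (ha : 0 ≤ a) (hst : s ≤ t) :
    1 - (1 - u) * Real.exp (-(a + 1) * s) ≤ 1 - (1 - u) * Real.exp (-(a + 1) * t) := by
  have : Real.exp (-(a + 1) * t) ≤ Real.exp (-(a + 1) * s) := Real.exp_le_exp.2 (by nlinarith)
  have : 0 < 1 - u := by linarith
  gcongr

section

variable {b : ℕ → ℝ} {m : ℕ} {v : ℝ}

theorem SolvesOn.le_one_sub_exp (hb : IsBranchingRates b) (hm : 1 < m) (hv : v ∈ Icc (0 : ℝ) 1)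
    {T : ℝ} {y : ℝ → ℝ} (hy : SolvesOn (crossingField b m v) T y)
    (hr : ∀ t ∈ Icc 0 T, y t ∈ Icc (0 : ℝ) 1) (h0 : y 0 < 1) :
    ∀ t ∈ Icc 0 T, y t ≤ 1 - (1 - y 0) * Real.exp (-(b 0 + 1) * t) :=
  le_one_sub_exp_of_deriv_right_le hy.continuousOn hy.deriv le_rfl h0
    (fun t ht _ => hb.crossingField_le hm hv (hr t (Ico_subset_Icc_self ht)))

theorem SolvesOn.lt_one (hb : IsBranchingRates b) (hm : 1 < m) (hv : v ∈ Icc (0 : ℝ) 1)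
    {T : ℝ} {y : ℝ → ℝ} (hy : SolvesOn (crossingField b m v) T y)
    (hr : ∀ t ∈ Icc 0 T, y t ∈ Icc (0 : ℝ) 1) (h0 : y 0 < 1) : ∀ t ∈ Icc 0 T, y t < 1 :=
  fun t ht => (hy.le_one_sub_exp hb hm hv hr h0 t ht).trans_lt (one_sub_mul_exp_lt_one h0)

/-- On [0,T] both solutions stay below one bound smaller than 1, where the field is Lipschitz. -/
theorem SolvesOn.eqOn (hb : IsBranchingRates b) (hm : 1 < m) (hv : v ∈ Icc (0 : ℝ) 1)
    {T : ℝ} {y z : ℝ → ℝ} (hy : SolvesOn (crossingField b m v) T y)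
    (hz : SolvesOn (crossingField b m v) T z) (hyr : ∀ t ∈ Icc 0 T, y t ∈ Icc (0 : ℝ) 1)
    (hzr : ∀ t ∈ Icc 0 T, z t ∈ Icc (0 : ℝ) 1) (h0 : y 0 < 1) (h : y 0 = z 0) :
    EqOn y z (Icc 0 T) := by
  rcases lt_or_ge T 0 with hT | hT
  · simp [Icc_eq_empty hT.not_ge]
  have hb0 : 0 ≤ b 0 := hb.nonneg 0 (by norm_num)
  have hmem : ∀ {w : ℝ → ℝ}, SolvesOn (crossingField b m v) T w →
      (∀ t ∈ Icc 0 T, w t ∈ Icc (0 : ℝ) 1) → w 0 = y 0 → ∀ t ∈ Ico 0 T,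
      w t ∈ Icc 0 (1 - (1 - y 0) * Real.exp (-(b 0 + 1) * T)) := by
    intro w hw hwr hw0 t ht
    refine ⟨(hwr t (Ico_subset_Icc_self ht)).1, ?_⟩
    have := hw.le_one_sub_exp hb hm hv hwr (by rwa [hw0]) t (Ico_subset_Icc_self ht)
    rw [hw0] at this
    exact this.trans (one_sub_mul_exp_mono h0 hb0 ht.2.le)
  have hr0 : 0 ≤ 1 - (1 - y 0) * Real.exp (-(b 0 + 1) * T) := by
    refine le_trans (hyr 0 ⟨le_rfl, hT⟩).1 ?_
    simpa using one_sub_mul_exp_mono (a := b 0) h0 hb0 hT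
  obtain ⟨K, hK⟩ := hb.exists_lipschitzOnWith_crossingField hr0 (one_sub_mul_exp_lt_one h0) m v
  exact ODE_solution_unique_of_mem_Icc_right (v := fun _ => crossingField b m v)
    (fun _ _ => hK) hy.continuousOn hy.deriv (hmem hy hyr rfl) hz.continuousOn hz.deriv
    (hmem hz hzr h.symm) h

theorem exists_solvesOn (hb : IsBranchingRates b) (hm : 1 < m) (hv : v ∈ Icc (0 : ℝ) 1)
    {u T : ℝ} (hu : u ∈ Ico (0 : ℝ) 1) (hT : 0 ≤ T) :
    ∃ y : ℝ → ℝ, ∃ r, 0 ≤ r ∧ r < 1 ∧ y 0 = u ∧ SolvesOn (crossingField b m v) T y ∧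
      ∀ t ∈ Icc 0 T, y t ∈ Icc 0 r := by
  have hb0 : 0 ≤ b 0 := hb.nonneg 0 (by norm_num)
  set r := 1 - (1 - u) * Real.exp (-(b 0 + 1) * T) with hr
  have hr1 : r < 1 := one_sub_mul_exp_lt_one hu.2
  have hur : u ≤ r := le_trans (by simp) (one_sub_mul_exp_mono hu.2 hb0 hT)
  have hr0 : 0 ≤ r := hu.1.trans hur
  obtain ⟨K, hK⟩ := hb.exists_lipschitzOnWith_crossingField hr0 hr1 m v
  obtain ⟨M, hM⟩ := isCompact_Icc.exists_bound_of_continuousOn hK.continuousOn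
  -- Freezing the field outside [0,r] makes it bounded and globally Lipschitz, so Picard-Lindelöf
  -- covers all of [0,T]. The solution then turns out to stay in [0,r], where nothing was changed.
  set g : ℝ → ℝ := fun x => crossingField b m v (projIcc 0 r hr0 x) with hg
  have hgL : LipschitzWith K g := by
    simpa [Function.comp_def] using hK.to_restrict.comp (LipschitzWith.projIcc hr0)
  have hgM : ∀ x, ‖g x‖ ≤ M := fun x => hM _ (projIcc 0 r hr0 x).2
  have hM0 : 0 ≤ M := (norm_nonneg _).trans (hgM 0)
  have hpl : IsPicardLindelof (fun _ => g) (⟨0, le_rfl, hT⟩ : Icc 0 T) u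
      (⟨M * T, by positivity⟩ : ℝ≥0) 0 ⟨M, hM0⟩ K :=
    ⟨fun _ _ => hgL.lipschitzOnWith, fun _ _ => continuousOn_const, fun _ _ x _ => hgM x, by
      simp only [sub_zero, sub_self, max_eq_left hT, NNReal.coe_zero]; exact le_rfl⟩
  obtain ⟨y, hy0, hy⟩ := hpl.exists_eq_forall_mem_Icc_hasDerivWithinAt₀
  have hc : ContinuousOn y (Icc 0 T) := fun t ht => (hy t ht).continuousWithinAt
  have hd : ∀ t ∈ Ico 0 T, HasDerivWithinAt y (g (y t)) (Ici t) t := by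
    intro t ht
    refine (hy t (Ico_subset_Icc_self ht)).mono_of_mem_nhdsWithin ?_
    exact mem_of_superset (Icc_mem_nhdsGE ht.2) (Icc_subset_Icc_left ht.1)
  have hnn : ∀ t ∈ Icc 0 T, 0 ≤ y t := by
    intro t ht
    have := nonpos_of_deriv_right_le (y := fun t => -y t) (K := 0) (δ := 1) hc.neg
      (fun s hs => (hd s hs).neg) (by simpa [hy0] using hu.1) one_pos le_rfl
      (fun s hs h1 _ => ?_) t ht
    · simpa using this
    · rw [hg]
      simp only
      -- Below 0 the frozen field is the constant b_0 ≥ 0, so y cannot decrease there.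
      rw [projIcc_of_le_left hr0 (by linarith), crossingField_zero hm]
      linarith
  have hle : ∀ t ∈ Icc 0 T, y t ≤ 1 - (1 - u) * Real.exp (-(b 0 + 1) * t) := by
    refine le_one_sub_exp_of_deriv_right_le hc hd hy0.le hu.2 (fun t ht heq => ?_)
    have h1 : y t ∈ Icc 0 r :=
      ⟨hnn t (Ico_subset_Icc_self ht), heq.le.trans (one_sub_mul_exp_mono hu.2 hb0 ht.2.le)⟩
    rw [hg]
    simp only
    rw [projIcc_of_mem hr0 h1]
    exact hb.crossingField_le hm hv ⟨h1.1, h1.2.trans hr1.le⟩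
  have hmem : ∀ t ∈ Icc 0 T, y t ∈ Icc 0 r := fun t ht =>
    ⟨hnn t ht, (hle t ht).trans (one_sub_mul_exp_mono hu.2 hb0 ht.2)⟩
  refine ⟨y, r, hr0, hr1, hy0, ⟨hc, fun t ht => ?_⟩, hmem⟩
  have := hd t ht
  rw [hg] at this
  simp only at this
  rwa [projIcc_of_mem hr0 (hmem t (Ico_subset_Icc_self ht))] at this

theorem IsSolution.solvesOn {u : ℝ} {y : ℝ → ℝ} (hy : IsSolution b m u v y) (T : ℝ) :
    SolvesOn (crossingField b m v) T y :=
  ⟨fun t ht => ((hy.deriv t ht.1).continuousWithinAt).mono Icc_subset_Ici_self,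
    fun t ht => (hy.deriv t ht.1).mono (Ici_subset_Ici.2 ht.1)⟩

/-- At 0 the field is b_0 ≥ 0 and at 1 it is -b_m(1-v) ≤ 0, so with a Lipschitz bound near each
endpoint the barrier argument applies. If y(t) > 1, the required convergence of B at y(t) supplies
that bound beyond 1. -/
theorem IsSolution.mem_Icc (hb : IsBranchingRates b) (hm : 1 < m) (hv : v ∈ Icc (0 : ℝ) 1)
    {u : ℝ} (hu : u ∈ Icc (0 : ℝ) 1) {y : ℝ → ℝ} (hy : IsSolution b m u v y) {t : ℝ}
    (ht : 0 ≤ t) : y t ∈ Icc (0 : ℝ) 1 := by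
  have hb0 : 0 ≤ b 0 := hb.nonneg 0 (by norm_num)
  have hs := hy.solvesOn t
  constructor
  · obtain ⟨K, hK, hL⟩ := exists_lipschitz_crossingField (ρ := 1 / 2) (by norm_num)
      (by norm_num) (hb.summable_mul_pow (x := 1) (by simp)) m v
    have := nonpos_of_deriv_right_le (y := fun t => -y t) (K := K) (δ := 1 / 2)
      hs.continuousOn.neg (fun s hs' => (hs.deriv s hs').neg) (by simpa [hy.init] using hu.1)
      (by norm_num) hK (fun s _ h1 h2 => ?_) t ⟨ht, le_rfl⟩
    · simpa using this
    · have := hL (y s) 0 (abs_le.2 ⟨by linarith, by linarith⟩) (by norm_num)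
      rw [crossingField_zero hm, sub_zero, abs_of_neg (by linarith : y s < 0)] at this
      linarith [(abs_le.1 this).1]
  · by_contra! h1
    obtain ⟨K, hK, hL⟩ := exists_lipschitz_crossingField (ρ := (1 + y t) / 2) (by linarith)
      (by linarith) (hy.summable t ht) m v
    have := nonpos_of_deriv_right_le (y := fun t => y t - 1) (K := K) (δ := (y t - 1) / 2)
      (hs.continuousOn.sub continuousOn_const) (fun s hs' => (hs.deriv s hs').sub_const 1)
      (by simpa [hy.init] using hu.2) (by linarith) hK (fun s _ h2 h3 => ?_) t ⟨ht, le_rfl⟩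
    · linarith
    · have h4 := hL (y s) 1 (abs_le.2 ⟨by linarith, by linarith⟩)
        (by rw [abs_one]; linarith)
      rw [hb.crossingField_one, abs_of_pos h2] at h4
      have h5 : 0 ≤ b m * (1 - v) := mul_nonneg (hb.nonneg m (by omega)) (by linarith [hv.2])
      linarith [(abs_le.1 h4).2]

end

/-! ### Counting crossings along a grid. -/

/-- The number of increments equal to `m - 1` among the first `k` increments of `x` over the
grid of mesh `h`. -/
def gridCount (x : ℝ≥0 → ℕ) (m : ℕ) (h : ℝ≥0) (k : ℕ) : ℕ :=
  ∑ l ∈ Finset.range k, if x ((l + 1 : ℕ) * h) + 1 = x (l * h) + m then 1 else 0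

theorem IsStepPath.exists_isOpen {x : ℝ≥0 → ℕ} (hx : IsStepPath x) (a : ℝ≥0) :
    ∃ U : Set ℝ≥0, IsOpen U ∧ a ∈ U ∧ (∃ c, ∀ s ∈ U, s < a → x s = c) ∧
      ∀ s ∈ U, a ≤ s → x s = x a := by
  obtain ⟨c, hc⟩ : ∃ c, ∀ᶠ s in 𝓝[<] a, x s = c := by
    rcases eq_or_lt_of_le (zero_le (a := a)) with h | h
    · subst h
      simp
    · exact hx.2 a h
  have h1 := eventually_nhdsWithin_iff.1 hc
  have h2 := eventually_nhdsWithin_iff.1 (hx.1 a)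
  obtain ⟨U, hU, hUo, haU⟩ := eventually_nhds_iff.1 (h1.and h2)
  refine ⟨U, hUo, haU, ⟨c, fun s hs hsa => (hU s hs).1 hsa⟩, fun s hs has => ?_⟩
  rcases has.eq_or_lt with rfl | h
  · rfl
  · exact (hU s hs).2 h

/-- Inside U the path takes one value before a and one from a on, so only a can be a jump. The
increment over [p,q] is then that jump or 0, and `m ≠ 1` keeps 0 from being counted. -/
theorem exists_leftLim_add_iff {x : ℝ≥0 → ℕ} {m c : ℕ} (hm : m ≠ 1) {U : Set ℝ≥0}
    {a p q s : ℝ≥0} (h1 : ∀ s ∈ U, s < a → x s = c) (h2 : ∀ s ∈ U, a ≤ s → x s = x a)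
    (hpq : Icc p q ⊆ U) (hs : s ∈ Ioc p q) :
    (∃ i, (∀ᶠ r in 𝓝[<] s, x r = i) ∧ x s + 1 = i + m) ↔ s = a ∧ x q + 1 = x p + m := by
  have hpq' : p ≤ q := hs.1.le.trans hs.2
  have : (𝓝[<] s).NeBot := nhdsLT_neBot_of_exists_lt ⟨p, hs.1⟩
  have hpU := hpq (left_mem_Icc.2 hpq')
  have hqU := hpq (right_mem_Icc.2 hpq')
  have hsU := hpq (Ioc_subset_Icc_self hs)
  have hleft : ∀ᶠ r in 𝓝[<] s, r ∈ U ∧ r < s := by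
    filter_upwards [Ioo_mem_nhdsLT hs.1] with r hr
    exact ⟨hpq ⟨hr.1.le, hr.2.le.trans hs.2⟩, hr.2⟩
  have huniq : ∀ {i d : ℕ}, (∀ᶠ r in 𝓝[<] s, x r = i) → (∀ᶠ r in 𝓝[<] s, x r = d) → i = d :=
    fun hi hd => by
      obtain ⟨r, hr1, hr2⟩ := (hi.and hd).exists
      exact hr1.symm.trans hr2
  rcases lt_trichotomy s a with hsa | hsa | hsa
  · have hl : ∀ᶠ r in 𝓝[<] s, x r = c := hleft.mono fun r hr => h1 r hr.1 (hr.2.trans hsa)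
    constructor
    · rintro ⟨i, hi, hi'⟩
      have := huniq hi hl
      rw [h1 s hsU hsa] at hi'
      omega
    · rintro ⟨rfl, -⟩
      exact absurd hsa (lt_irrefl _)
  · subst hsa
    have hl : ∀ᶠ r in 𝓝[<] s, x r = c := hleft.mono fun r hr => h1 r hr.1 hr.2
    rw [h2 q hqU hs.2, h1 p hpU hs.1]
    constructor
    · rintro ⟨i, hi, hi'⟩
      rw [← huniq hi hl]
      exact ⟨rfl, hi'⟩
    · rintro ⟨-, h⟩
      exact ⟨c, hl, h⟩
  · have hl : ∀ᶠ r in 𝓝[<] s, x r = x a := by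
      filter_upwards [hleft, Ioo_mem_nhdsLT hsa] with r hr hr'
      exact h2 r hr.1 hr'.1.le
    constructor
    · rintro ⟨i, hi, hi'⟩
      have := huniq hi hl
      rw [h2 s hsU hsa.le] at hi'
      omega
    · rintro ⟨rfl, -⟩
      exact absurd hsa (lt_irrefl _)

theorem crossingNumber_step {x : ℝ≥0 → ℕ} (hx : IsStepPath x) {m c : ℕ} (hm : m ≠ 1)
    {U : Set ℝ≥0} {a p q : ℝ≥0} (h1 : ∀ s ∈ U, s < a → x s = c)
    (h2 : ∀ s ∈ U, a ≤ s → x s = x a) (hle : p ≤ q) (hpq : Icc p q ⊆ U) :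
    crossingNumber x m q = crossingNumber x m p + if x q + 1 = x p + m then 1 else 0 := by
  have hpU := hpq (left_mem_Icc.2 hle)
  have hqU := hpq (right_mem_Icc.2 hle)
  have hmem : ∀ s, s ∈ crossingTimes x m q ↔
      s ∈ crossingTimes x m p ∨ (s ∈ Ioc p q ∧ s = a ∧ x q + 1 = x p + m) := by
    intro s
    rcases le_or_gt s p with hsp | hsp
    · simp [crossingTimes, hsp, hsp.trans hle, hsp.not_gt]
    · by_cases hsq : s ≤ q
      · rw [← exists_leftLim_add_iff hm h1 h2 hpq ⟨hsp, hsq⟩ (s := s)]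
        simp [crossingTimes, hsp, hsq, hsp.not_ge, (zero_le (a := p)).trans_lt hsp]
      · simp [crossingTimes, hsq, hsp.not_ge]
  split_ifs with hcond
  · have ha : a ∈ Ioc p q := by
      constructor
      · by_contra! hap
        rw [h2 p hpU hap, h2 q hqU (hap.trans hle)] at hcond
        omega
      · by_contra! hqa
        rw [h1 p hpU (hle.trans_lt hqa), h1 q hqU hqa] at hcond
        omega
    have : crossingTimes x m q = insert a (crossingTimes x m p) := by
      ext s
      rw [hmem, mem_insert_iff, or_comm]
      constructor
      · rintro (⟨-, h, -⟩ | h)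
        · exact Or.inl h
        · exact Or.inr h
      · rintro (rfl | h)
        · exact Or.inl ⟨ha, rfl, hcond⟩
        · exact Or.inr h
    rw [crossingNumber, this, ncard_insert_of_notMem (fun h => ha.1.not_ge h.2.1)
      (crossingTimes_finite hx hm p), crossingNumber]
  · have : crossingTimes x m q = crossingTimes x m p := by
      ext s
      simp [hmem, hcond]
    rw [crossingNumber, this, crossingNumber, add_zero]

theorem crossingNumber_zero (x : ℝ≥0 → ℕ) (m : ℕ) : crossingNumber x m 0 = 0 := by
  have : crossingTimes x m 0 = ∅ := by
    ext s
    simp only [crossingTimes, mem_ofPred_eq, mem_empty_iff_false, iff_false]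
    rintro ⟨h0, h0', -⟩
    exact h0.not_ge h0'
  simp [crossingNumber, this]

/-- By compactness there is a Lebesgue number δ for the cover of [0,t] by the neighbourhoods of
`IsStepPath.exists_isOpen`. For mesh below δ each grid interval lies in one of them and contains at
most one jump. -/
theorem IsStepPath.exists_gridCount_eq {x : ℝ≥0 → ℕ} (hx : IsStepPath x) {m : ℕ} (hm : m ≠ 1)
    (t : ℝ≥0) : ∃ δ > 0, ∀ h : ℝ≥0, (h : ℝ) < δ → ∀ k : ℕ, k * h ≤ t →
      gridCount x m h k = crossingNumber x m (k * h) := by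
  choose U hUo haU hU1 hU2 using hx.exists_isOpen
  choose c hc using hU1
  obtain ⟨δ, hδ, H⟩ := lebesgue_number_lemma_of_metric (isCompact_Icc (a := (0 : ℝ≥0)) (b := t))
    hUo (fun s _ => mem_iUnion.2 ⟨s, haU s⟩)
  refine ⟨δ, hδ, fun h hh k => ?_⟩
  induction k with
  | zero =>
    intro _
    simp [gridCount, crossingNumber_zero]
  | succ k ih =>
    intro hk
    have hle : (k : ℝ≥0) * h ≤ (k + 1 : ℕ) * h := by
      gcongr
      simp
    obtain ⟨a, ha⟩ := H (k * h) ⟨zero_le, hle.trans hk⟩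
    have hsub : Icc ((k : ℝ≥0) * h) ((k + 1 : ℕ) * h) ⊆ U a := by
      refine Subset.trans (fun s hs => ?_) ha
      have h1 : (k : ℝ) * h ≤ s := by exact_mod_cast hs.1
      have h2 : (s : ℝ) ≤ (k + 1) * h := by exact_mod_cast hs.2
      rw [Metric.mem_ball, NNReal.dist_eq, NNReal.coe_mul, NNReal.coe_natCast,
        abs_of_nonneg (by linarith)]
      linarith
    rw [crossingNumber_step hx hm (hc a) (hU2 a) hle hsub, ← ih (hle.trans hk), gridCount,
      Finset.sum_range_succ, gridCount]

theorem IsStepPath.tendsto_gridCount {x : ℝ≥0 → ℕ} (hx : IsStepPath x) {m : ℕ} (hm : m ≠ 1)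
    (t : ℝ≥0) : ∀ᶠ n : ℕ in atTop, gridCount x m (t / n) n = crossingNumber x m t := by
  obtain ⟨δ, hδ, H⟩ := hx.exists_gridCount_eq hm t
  have hlim : Tendsto (fun n : ℕ => (t : ℝ) / n) atTop (𝓝 0) :=
    tendsto_const_div_atTop_nhds_zero_nat _
  filter_upwards [hlim.eventually_lt_const hδ, eventually_gt_atTop 0] with n hn hn0
  have hn' : (n : ℝ≥0) * (t / n) = t := mul_div_cancel₀ _ (by positivity)
  rw [H (t / n) (by simpa using hn) n hn'.le, hn']

/-- The values of `X` at the first `k + 1` points of the grid of mesh `h`. -/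
def gridHistory {Ω : Type*} (X : ℝ≥0 → Ω → ℕ) (h : ℝ≥0) (k : ℕ) (ω : Ω) : Fin (k + 1) → ℕ :=
  fun l => X ((l : ℕ) * h) ω

theorem exists_gridCount_eq_comp_gridHistory {Ω : Type*} (X : ℝ≥0 → Ω → ℕ) (m : ℕ)
    (h : ℝ≥0) (k : ℕ) :
    ∃ N : (Fin (k + 1) → ℕ) → ℕ,
      ∀ ω, gridCount (fun s => X s ω) m h k = N (gridHistory X h k ω) := by
  refine ⟨fun a => ∑ l : Fin k, if a l.succ + 1 = a l.castSucc + m then 1 else 0, fun ω => ?_⟩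
  rw [gridCount, Finset.sum_range]
  rfl

/-! ### Conditioning on the grid history. -/

section Markov

variable {Ω : Type*} [MeasurableSpace Ω] {μ : Measure Ω}

/-- The finite-dimensional Markov property of `X` with respect to the transition function `p`. -/
def HasTransition (μ : Measure Ω) (X : ℝ≥0 → Ω → ℕ) (p : ℝ → ℕ → ℕ → ℝ) : Prop :=
  ∀ (n : ℕ) (t : ℕ → ℝ≥0) (x : ℕ → ℕ), Monotone t →
    μ.real {ω | ∀ k ≤ n + 1, X (t k) ω = x k} =
      μ.real {ω | ∀ k ≤ n, X (t k) ω = x k} *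
        p ((t (n + 1) : ℝ) - (t n : ℝ)) (x n) (x (n + 1))

theorem measurable_gridHistory {X : ℝ≥0 → Ω → ℕ} (hX : ∀ t, Measurable (X t)) (h : ℝ≥0)
    (k : ℕ) : Measurable (gridHistory X h k) :=
  measurable_pi_lambda _ fun _ => hX _

/-- Histories form a countable space, so it suffices to compare singletons, where this is the
finite-dimensional Markov property. -/
theorem map_gridHistory_restrict [IsProbabilityMeasure μ] {X : ℝ≥0 → Ω → ℕ}
    {p : ℝ → ℕ → ℕ → ℝ} (hX : ∀ t, Measurable (X t)) (hp : IsTransitionFunction p)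
    (hM : HasTransition μ X p) (h : ℝ≥0) (k i j : ℕ) :
    (μ.restrict {ω | X (k * h) ω = i ∧ X ((k + 1 : ℕ) * h) ω = j}).map (gridHistory X h k) =
      ENNReal.ofReal (p h i j) •
        (μ.restrict {ω | X (k * h) ω = i}).map (gridHistory X h k) := by
  have hms : ∀ t i, MeasurableSet {ω | X t ω = i} := fun t i => hX t (measurableSet_singleton i)
  have hH := measurable_gridHistory hX h k
  refine Measure.ext_of_singleton fun a => ?_
  have hpre : MeasurableSet (gridHistory X h k ⁻¹' {a}) := hH (measurableSet_singleton a)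
  rw [Measure.smul_apply, Measure.map_apply hH (measurableSet_singleton a),
    Measure.map_apply hH (measurableSet_singleton a), Measure.restrict_apply hpre,
    Measure.restrict_apply hpre, smul_eq_mul]
  have hlast : ∀ ω, gridHistory X h k ω = a → X (k * h) ω = a (Fin.last k) := by
    rintro ω rfl
    rfl
  by_cases ha : a (Fin.last k) = i
  -- The history a is continued by j, so that the index k + 1 carries the next state.
  · set x : ℕ → ℕ := fun l => if hl : l < k + 1 then a ⟨l, hl⟩ else j with hx
    have hE1 : gridHistory X h k ⁻¹' {a} ∩ {ω | X (k * h) ω = i} =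
        {ω | ∀ l ≤ k, X ((l : ℝ≥0) * h) ω = x l} := by
      ext ω
      constructor
      · rintro ⟨h1, -⟩ l hl
        rw [mem_preimage, mem_singleton_iff] at h1
        simp only [hx, Nat.lt_succ_of_le hl, dif_pos, ← h1]
        rfl
      · intro h1
        have : gridHistory X h k ω = a := by
          funext l
          have := h1 l (Nat.lt_succ_iff.1 l.2)
          simp only [hx, dif_pos l.2] at this
          exact this
        exact ⟨this, (hlast ω this).trans ha⟩
    have hE2 : gridHistory X h k ⁻¹' {a} ∩
        {ω | X (k * h) ω = i ∧ X ((k + 1 : ℕ) * h) ω = j} =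
        {ω | ∀ l ≤ k + 1, X ((l : ℝ≥0) * h) ω = x l} := by
      have hk1 : x (k + 1) = j := by simp [hx]
      ext ω
      constructor
      · rintro ⟨h1, h2, h3⟩ l hl
        rcases Nat.lt_succ_iff_lt_or_eq.1 (Nat.lt_succ_of_le hl) with hl | rfl
        · have : ω ∈ {ω | ∀ l ≤ k, X ((l : ℝ≥0) * h) ω = x l} := hE1 ▸ ⟨h1, h2⟩
          exact this l (Nat.lt_succ_iff.1 hl)
        · rw [hk1]
          exact h3
      · intro h1
        have h2 : ω ∈ gridHistory X h k ⁻¹' {a} ∩ {ω | X (k * h) ω = i} :=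
          hE1 ▸ fun l hl => h1 l (hl.trans (Nat.le_succ k))
        exact ⟨h2.1, h2.2, (h1 (k + 1) le_rfl).trans hk1⟩
    have hmono : Monotone fun l : ℕ => (l : ℝ≥0) * h := fun l l' hl => by
      dsimp only
      gcongr
    have hM' := hM k (fun l => (l : ℝ≥0) * h) x hmono
    have hxk : x k = i := by
      simp only [hx, Nat.lt_succ_self, dif_pos]
      exact ha
    have hxk1 : x (k + 1) = j := by simp [hx]
    have hdiff : (((k + 1 : ℕ) : ℝ≥0) * h : ℝ≥0) - ((k : ℝ≥0) * h : ℝ≥0) = (h : ℝ) := by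
      push_cast
      ring
    rw [hdiff, hxk, hxk1, ← hE1, ← hE2] at hM'
    rw [← ENNReal.ofReal_toReal (measure_ne_top μ (gridHistory X h k ⁻¹' {a} ∩
        {ω | X (k * h) ω = i ∧ X ((k + 1 : ℕ) * h) ω = j})),
      ← ENNReal.ofReal_toReal (measure_ne_top μ (gridHistory X h k ⁻¹' {a} ∩
        {ω | X (k * h) ω = i})), ← ENNReal.ofReal_mul (hp.nonneg h h.2 i j),
      mul_comm (p h i j)]
    exact congrArg ENNReal.ofReal hM'
  · have h1 : gridHistory X h k ⁻¹' {a} ∩ {ω | X (k * h) ω = i} = ∅ := by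
      ext ω
      simp only [mem_inter_iff, mem_preimage, mem_singleton_iff, mem_ofPred_eq,
        mem_empty_iff_false, iff_false]
      rintro ⟨h1, h2⟩
      exact ha ((hlast ω h1).symm.trans h2)
    have h2 : gridHistory X h k ⁻¹' {a} ∩
        {ω | X (k * h) ω = i ∧ X ((k + 1 : ℕ) * h) ω = j} = ∅ :=
      subset_empty_iff.1 (h1 ▸ inter_subset_inter_right _ fun ω hω => hω.1)
    rw [h1, h2]
    simp

theorem setIntegral_gridHistory [IsProbabilityMeasure μ] {X : ℝ≥0 → Ω → ℕ}
    {p : ℝ → ℕ → ℕ → ℝ} (hX : ∀ t, Measurable (X t)) (hp : IsTransitionFunction p)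
    (hM : HasTransition μ X p) (h : ℝ≥0) (k i j : ℕ) (F : (Fin (k + 1) → ℕ) → ℝ) :
    ∫ ω in {ω | X (k * h) ω = i ∧ X ((k + 1 : ℕ) * h) ω = j}, F (gridHistory X h k ω) ∂μ =
      p h i j * ∫ ω in {ω | X (k * h) ω = i}, F (gridHistory X h k ω) ∂μ := by
  have hH := (measurable_gridHistory hX h k)
  have hF : ∀ ν : Measure (Fin (k + 1) → ℕ), AEStronglyMeasurable F ν := fun ν =>
    (measurable_of_countable F).aestronglyMeasurable
  rw [← integral_map hH.aemeasurable (hF _), ← integral_map hH.aemeasurable (hF _),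
    map_gridHistory_restrict hX hp hM, integral_smul_measure,
    ENNReal.toReal_ofReal (hp.nonneg h h.2 i j), smul_eq_mul]

theorem hasSum_measureReal_eq [IsProbabilityMeasure μ] {Y : Ω → ℕ} (hY : Measurable Y) :
    HasSum (fun i => μ.real {ω | Y ω = i}) 1 := by
  have := hasSum_integral_iUnion (μ := μ) (f := fun _ => (1 : ℝ)) (s := fun i => {ω | Y ω = i})
    (fun i => hY (measurableSet_singleton i))
    (fun i j hij => disjoint_left.2 fun ω (h1 : Y ω = i) (h2 : Y ω = j) => hij (h1.symm.trans h2))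
    (integrable_const _).integrableOn
  have hU : ⋃ i, {ω | Y ω = i} = univ := eq_univ_of_forall fun ω => mem_iUnion.2 ⟨Y ω, rfl⟩
  simpa [hU] using this

/-- Given the history up to step k, the mean of g(i,·) under p_i·(h) is at most ε in absolute value.
Splitting Ω by the pair (current state, next state), summing over the next state first and using |F|
≤ 1 leaves ε times a total mass of 1. -/
theorem abs_integral_gridHistory_mul_le [IsProbabilityMeasure μ] {X : ℝ≥0 → Ω → ℕ}
    {p : ℝ → ℕ → ℕ → ℝ} (hX : ∀ t, Measurable (X t)) (hp : IsTransitionFunction p)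
    (hM : HasTransition μ X p) (h : ℝ≥0) (k : ℕ) {F : (Fin (k + 1) → ℕ) → ℝ}
    (hF : ∀ a, |F a| ≤ 1) {g : ℕ → ℕ → ℝ} {D ε : ℝ} (hg : ∀ i j, |g i j| ≤ D)
    (hε : ∀ i, |∑' j, p h i j * g i j| ≤ ε) :
    |∫ ω, F (gridHistory X h k ω) * g (X (k * h) ω) (X ((k + 1 : ℕ) * h) ω) ∂μ| ≤ ε := by
  set s : ℕ × ℕ → Set Ω := fun ij => {ω | X (k * h) ω = ij.1 ∧ X ((k + 1 : ℕ) * h) ω = ij.2}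
    with hs
  set f : Ω → ℝ := fun ω =>
    F (gridHistory X h k ω) * g (X (k * h) ω) (X ((k + 1 : ℕ) * h) ω) with hf
  have hFm : Measurable fun ω => F (gridHistory X h k ω) :=
    (measurable_of_countable F).comp (measurable_gridHistory hX h k)
  have hgm : Measurable fun ω => g (X (k * h) ω) (X ((k + 1 : ℕ) * h) ω) :=
    (measurable_of_countable fun ij : ℕ × ℕ => g ij.1 ij.2).comp ((hX _).prodMk (hX _))
  have hint : Integrable f μ := by
    refine Integrable.of_bound (hFm.mul hgm).aestronglyMeasurable (1 * D)
      (Eventually.of_forall fun ω => ?_)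
    rw [norm_mul]
    exact mul_le_mul (hF _) (hg _ _) (norm_nonneg _) zero_le_one
  have hU : ⋃ ij, s ij = univ :=
    eq_univ_of_forall fun ω => mem_iUnion.2 ⟨(X (k * h) ω, X ((k + 1 : ℕ) * h) ω), rfl, rfl⟩
  have hsm : ∀ ij, MeasurableSet (s ij) := fun ij =>
    (hX _ (measurableSet_singleton _)).inter (hX _ (measurableSet_singleton _))
  have hsum := hasSum_integral_iUnion (μ := μ) (f := f) (s := s) hsm
    (fun ij ij' hne => disjoint_left.2 fun ω h1 h2 =>
      hne (Prod.ext (h1.1.symm.trans h2.1) (h1.2.symm.trans h2.2))) hint.integrableOn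
  rw [hU, setIntegral_univ] at hsum
  set A : ℕ → ℝ := fun i => ∫ ω in {ω | X (k * h) ω = i}, F (gridHistory X h k ω) ∂μ with hA
  have hcell : ∀ i j, ∫ ω in s (i, j), f ω ∂μ = p h i j * g i j * A i := by
    intro i j
    have h1 : ∫ ω in s (i, j), f ω ∂μ = ∫ ω in s (i, j), F (gridHistory X h k ω) * g i j ∂μ := by
      refine setIntegral_congr_fun (hsm _) fun ω hω => ?_
      simp only [hf]
      rw [hω.1, hω.2]
    rw [h1, integral_mul_const, setIntegral_gridHistory hX hp hM]
    ring
  have hrow : ∀ i, HasSum (fun j => ∫ ω in s (i, j), f ω ∂μ) ((∑' j, p h i j * g i j) * A i) := by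
    intro i
    simp only [hcell]
    refine HasSum.mul_right _ (Summable.hasSum ?_)
    refine Summable.of_norm_bounded ((hp.hasSum_one h h.2 i).summable.mul_right D) fun j => ?_
    rw [norm_mul, Real.norm_of_nonneg (hp.nonneg h h.2 i j)]
    exact mul_le_mul_of_nonneg_left (hg i j) (hp.nonneg h h.2 i j)
  have hfin := hsum.prod_fiberwise hrow
  have hAle : ∀ i, |A i| ≤ μ.real {ω | X (k * h) ω = i} := by
    intro i
    have := norm_setIntegral_le_of_norm_le_const (μ := μ) (s := {ω | X (k * h) ω = i}) (C := 1)
      (f := fun ω => F (gridHistory X h k ω)) (measure_lt_top _ _) (fun ω _ => hF _)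
    simpa using this
  rw [← hfin.tsum_eq, ← Real.norm_eq_abs]
  have := tsum_of_norm_bounded ((hasSum_measureReal_eq (μ := μ) (hX (k * h))).mul_left ε)
    (f := fun i => (∑' j, p h i j * g i j) * A i) fun i => by
      rw [norm_mul]
      exact mul_le_mul (hε i) (hAle i) (norm_nonneg _) ((abs_nonneg _).trans (hε i))
  simpa using this

end Markov

/-! ### Short-time expansions, uniform in the initial state. -/

/-- The factor `v` for a transition that is an `(m - 1)`-range up-crossing, and `1` otherwise. -/
def crossingWeight (m : ℕ) (v : ℝ) (i j : ℕ) : ℝ := if j + 1 = i + m then v else 1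

theorem abs_crossingWeight_le (m : ℕ) {v : ℝ} (hv : v ∈ Icc (0 : ℝ) 1) (i j : ℕ) :
    |crossingWeight m v i j| ≤ 1 := by
  rw [crossingWeight]
  split_ifs
  · rw [abs_of_nonneg hv.1]
    exact hv.2
  · simp

theorem crossingWeight_self {m : ℕ} (hm : m ≠ 1) (v : ℝ) (i : ℕ) : crossingWeight m v i i = 1 :=
  if_neg (by omega)

section

variable {b : ℕ → ℝ} {p : ℝ → ℕ → ℕ → ℝ}

/-- Since q_ij = 0 unless i ≤ j + 1, the factor i is controlled by j. This is the source of
uniformity in i of all later estimates. -/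
theorem abs_branchingQ_le (hb : IsBranchingRates b) (i j : ℕ) :
    |branchingQ b i j| ≤ (j + 2) * ∑' l, |b l| := by
  have h0 : 0 ≤ ∑' l, |b l| := tsum_nonneg fun l => abs_nonneg _
  rw [branchingQ]
  split_ifs with h
  · rw [abs_mul, Nat.abs_cast]
    have h1 : (i : ℝ) ≤ j + 1 := by exact_mod_cast h.2
    have h2 := hb.summable_abs.le_tsum (j + 1 - i) fun l _ => abs_nonneg _
    exact mul_le_mul (by linarith) h2 (abs_nonneg _) (by positivity)
  · rw [abs_zero]
    positivity

theorem branchingQ_eq_zero {i j : ℕ} (h : j + 1 < i) : branchingQ b i j = 0 :=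
  if_neg (by omega)

theorem abs_tsum_mul_branchingQ_le (hb : IsBranchingRates b) (hp : IsTransitionFunction p)
    {t : ℝ} (ht : 0 ≤ t) (i j : ℕ) :
    |∑' k, p t i k * branchingQ b k j| ≤ (j + 2) * ∑' l, |b l| := by
  have := tsum_of_norm_bounded ((hp.hasSum_one t ht i).mul_right ((j + 2) * ∑' l, |b l|))
    (f := fun k => p t i k * branchingQ b k j) fun k => by
      rw [norm_mul, Real.norm_of_nonneg (hp.nonneg t ht i k)]
      exact mul_le_mul_of_nonneg_left (abs_branchingQ_le hb k j) (hp.nonneg t ht i k)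
  simpa using this

theorem abs_transition_sub_le (hb : IsBranchingRates b) (hp : IsTransitionFunction p)
    (hf : ForwardEquation b p) {t : ℝ} (ht : 0 ≤ t) (i j : ℕ) :
    |p t i j - if i = j then 1 else 0| ≤ (j + 2) * (∑' l, |b l|) * t := by
  have := norm_image_sub_le_of_norm_deriv_right_le_segment (f := fun s => p s i j) (a := 0) (b := t)
    (fun s hs => ((hf i j s hs.1).continuousWithinAt).mono Icc_subset_Ici_self)
    (fun s hs => (hf i j s hs.1).mono (Ici_subset_Ici.2 hs.1))
    (fun s hs => abs_tsum_mul_branchingQ_le hb hp hs.1 i j) t ⟨ht, le_rfl⟩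
  simpa [hp.zero] using this

theorem abs_forward_sub_le (hb : IsBranchingRates b) (hp : IsTransitionFunction p)
    (hf : ForwardEquation b p) {t : ℝ} (ht : 0 ≤ t) (i j : ℕ) :
    |∑' k, p t i k * branchingQ b k j - branchingQ b i j| ≤
      (j + 3) ^ 3 * (∑' l, |b l|) ^ 2 * t := by
  set β := ∑' l, |b l| with hβ
  have hβ0 : 0 ≤ β := tsum_nonneg fun l => abs_nonneg _
  have h1 : ∑' k, p t i k * branchingQ b k j =
      ∑ k ∈ Finset.range (j + 2), p t i k * branchingQ b k j :=
    tsum_eq_sum fun k hk => by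
      rw [branchingQ_eq_zero (by simp at hk; omega), mul_zero]
  have h2 : branchingQ b i j =
      ∑ k ∈ Finset.range (j + 2), (if i = k then 1 else 0) * branchingQ b k j := by
    simp only [ite_mul, one_mul, zero_mul, Finset.sum_ite_eq, Finset.mem_range]
    split_ifs with h
    · rfl
    · exact branchingQ_eq_zero (by omega)
  rw [h1, h2, ← Finset.sum_sub_distrib]
  refine (Finset.abs_sum_le_sum_abs _ _).trans ?_
  have h3 : ∀ k ∈ Finset.range (j + 2), |p t i k * branchingQ b k j -
      (if i = k then 1 else 0) * branchingQ b k j| ≤ (j + 3) * β * t * ((j + 3) * β) := by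
    intro k hk
    rw [← sub_mul, abs_mul]
    have hk' : (k : ℝ) ≤ j + 1 := by
      have := Finset.mem_range.1 hk
      exact_mod_cast (by omega : k ≤ j + 1)
    refine mul_le_mul ((abs_transition_sub_le hb hp hf ht i k).trans ?_)
      ((abs_branchingQ_le hb k j).trans ?_) (abs_nonneg _) (by positivity)
    · gcongr ?_ * β * t
      linarith
    · gcongr ?_ * β
      linarith
  refine (Finset.sum_le_sum h3).trans ?_
  rw [Finset.sum_const, Finset.card_range, nsmul_eq_mul]
  push_cast
  have : ((j : ℝ) + 2) * ((j + 3) * β * t * ((j + 3) * β)) ≤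
      (j + 3) * ((j + 3) * β * t * ((j + 3) * β)) := by
    gcongr
    norm_num
  linarith

/-- The forward equation is integrated twice. The polynomial growth in j is harmless: it is later
paired with r^j for some r < 1. -/
theorem abs_transition_sub_sub_le (hb : IsBranchingRates b) (hp : IsTransitionFunction p)
    (hf : ForwardEquation b p) {t : ℝ} (ht : 0 ≤ t) (i j : ℕ) :
    |p t i j - (if i = j then 1 else 0) - t * branchingQ b i j| ≤
      (j + 3) ^ 3 * (∑' l, |b l|) ^ 2 * t ^ 2 := by
  have hd : ∀ s, 0 ≤ s → HasDerivWithinAt (fun s => p s i j - s * branchingQ b i j)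
      (∑' k, p s i k * branchingQ b k j - branchingQ b i j) (Ici 0) s := fun s hs =>
    (hf i j s hs).sub (by
      simpa using (hasDerivWithinAt_id s (Ici 0)).mul_const (branchingQ b i j))
  have := norm_image_sub_le_of_norm_deriv_right_le_segment (a := 0) (b := t)
    (C := (j + 3) ^ 3 * (∑' l, |b l|) ^ 2 * t)
    (fun s hs => ((hd s hs.1).continuousWithinAt).mono Icc_subset_Ici_self)
    (fun s hs => (hd s hs.1).mono (Ici_subset_Ici.2 hs.1))
    (fun s hs => (abs_forward_sub_le hb hp hf hs.1 i j).trans (by gcongr; exact hs.2.le))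
    t ⟨ht, le_rfl⟩
  simp only [hp.zero, zero_mul, sub_zero, Real.norm_eq_abs] at this
  rw [sub_right_comm]
  exact this.trans_eq (by ring)

theorem hasSum_branchingQ_mul_crossingWeight (hb : IsBranchingRates b) (m : ℕ) (v : ℝ) (i : ℕ)
    {x : ℝ} (hx : |x| ≤ 1) :
    HasSum (fun j => branchingQ b i j * crossingWeight m v i j * x ^ j)
      (i * x ^ (i - 1) * crossingField b m v x) := by
  rcases i with _ | i
  · simp [branchingQ, hasSum_zero]
  have h1 : HasSum (fun l => b l * x ^ l - if l = m then b m * (1 - v) * x ^ m else 0)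
      (crossingField b m v x) :=
    (hb.summable_mul_pow hx).hasSum.sub (hasSum_ite_eq m _)
  have h2 := h1.mul_left (((i + 1 : ℕ) : ℝ) * x ^ i)
  -- With i + 1 particles the next state is j = i + l, where l is the number of offspring; the
  -- weight differs from 1 only at l = m.
  rw [Nat.add_sub_cancel, ← (add_right_injective i).hasSum_iff]
  · refine h2.congr_fun fun l => ?_
    have hc : i + l + 1 = i + 1 + m ↔ l = m := by omega
    have hq : 1 ≤ i + 1 ∧ i + 1 ≤ i + l + 1 := by omega
    have hs : i + l + 1 - (i + 1) = l := by omega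
    simp only [Function.comp_apply, branchingQ, crossingWeight, hc, if_pos hq, hs]
    split_ifs with h
    · subst h
      rw [pow_add]
      ring
    · rw [pow_add]
      ring
  · intro j hj
    have hji : j < i := by
      by_contra! h
      exact hj ⟨j - i, by simp; omega⟩
    rw [branchingQ_eq_zero (by omega)]
    ring

/-- The function is the power series with coefficients q_ij w_ij, which are bounded by (j+2) ∑ |b_l|
whatever i is; hence one L for all i. -/
theorem exists_lipschitz_mul_pow_mul_crossingField (hb : IsBranchingRates b) (m : ℕ) {v : ℝ}
    (hv : v ∈ Icc (0 : ℝ) 1) {r : ℝ} (h0 : 0 ≤ r) (h1 : r < 1) :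
    ∃ L, 0 ≤ L ∧ ∀ (i : ℕ) (x y : ℝ), |x| ≤ r → |y| ≤ r →
      |i * x ^ (i - 1) * crossingField b m v x - i * y ^ (i - 1) * crossingField b m v y| ≤
        L * |x - y| := by
  have hβ0 : 0 ≤ ∑' l, |b l| := tsum_nonneg fun l => abs_nonneg _
  have hs : Summable fun j : ℕ => ((j : ℝ) + 2) * (∑' l, |b l|) * j * r ^ (j - 1) :=
    ((summable_natCast_mul_pow_pred h0 h1 1).mul_left (∑' l, |b l|)).congr fun j => by ring
  refine ⟨∑' j : ℕ, ((j : ℝ) + 2) * (∑' l, |b l|) * j * r ^ (j - 1),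
    tsum_nonneg fun j => by positivity, fun i x y hx hy => ?_⟩
  have hx' := hasSum_branchingQ_mul_crossingWeight hb m v i (hx.trans h1.le)
  have hy' := hasSum_branchingQ_mul_crossingWeight hb m v i (hy.trans h1.le)
  rw [← hx'.tsum_eq, ← hy'.tsum_eq]
  refine abs_tsum_mul_pow_sub_le (fun j => ?_) hs hx hy hx'.summable hy'.summable
  rw [abs_mul]
  exact (mul_le_of_le_one_right (abs_nonneg _) (abs_crossingWeight_le m hv i j)).trans
    (abs_branchingQ_le hb i j)

theorem summable_add_three_pow_mul_pow {r : ℝ} (h0 : 0 ≤ r) (h1 : r < 1) :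
    Summable fun j : ℕ => ((j : ℝ) + 3) ^ 3 * r ^ j := by
  have := (summable_nat_add_iff 1).2 (summable_natCast_mul_pow_pred h0 h1 3)
  refine Summable.of_nonneg_of_le (fun j => by positivity) (fun j => ?_) this
  rw [Nat.add_sub_cancel]
  push_cast
  rw [show (j : ℝ) + 1 + 2 = j + 3 by ring]
  gcongr
  exact le_mul_of_one_le_right (by positivity) (by linarith [Nat.cast_nonneg (α := ℝ) j])

theorem abs_tsum_transition_sub_le (hb : IsBranchingRates b) (hp : IsTransitionFunction p)
    (hf : ForwardEquation b p) {m : ℕ} (hm : m ≠ 1) {v : ℝ} (hv : v ∈ Icc (0 : ℝ) 1) {r w : ℝ}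
    (h1 : r < 1) (hw : w ∈ Icc 0 r) {h : ℝ} (hh : 0 ≤ h) (i : ℕ) :
    |∑' j, p h i j * (crossingWeight m v i j * w ^ j) - w ^ i -
        h * (i * w ^ (i - 1) * crossingField b m v w)| ≤
      (∑' l, |b l|) ^ 2 * (∑' j : ℕ, ((j : ℝ) + 3) ^ 3 * r ^ j) * h ^ 2 := by
  have hw1 : w ≤ 1 := hw.2.trans h1.le
  have hs1 : Summable fun j => p h i j * (crossingWeight m v i j * w ^ j) := by
    refine Summable.of_norm_bounded (hp.hasSum_one h hh i).summable fun j => ?_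
    rw [norm_mul, Real.norm_of_nonneg (hp.nonneg h hh i j), norm_mul, norm_pow,
      Real.norm_of_nonneg hw.1]
    exact mul_le_of_le_one_right (hp.nonneg h hh i j) (mul_le_one₀ (abs_crossingWeight_le m hv i j)
      (pow_nonneg hw.1 j) (pow_le_one₀ hw.1 hw1))
  have hs2 : HasSum (fun j => if j = i then w ^ i else 0) (w ^ i) := hasSum_ite_eq i _
  have hs3 := (hasSum_branchingQ_mul_crossingWeight hb m v i (x := w)
    (by rw [abs_of_nonneg hw.1]; exact hw1)).mul_left h
  rw [← ((hs1.hasSum.sub hs2).sub hs3).tsum_eq, ← Real.norm_eq_abs]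
  have hs4 := (summable_add_three_pow_mul_pow (hw.1.trans hw.2) h1).hasSum
  refine tsum_of_norm_bounded ((hs4.mul_left ((∑' l, |b l|) ^ 2)).mul_right (h ^ 2)) fun j => ?_
  -- The weight is 1 on the diagonal because m ≠ 1, so it factors out of the identity term as well.
  have he : p h i j * (crossingWeight m v i j * w ^ j) - (if j = i then w ^ i else 0) -
      h * (branchingQ b i j * crossingWeight m v i j * w ^ j) =
      (p h i j - (if i = j then 1 else 0) - h * branchingQ b i j) *
        (crossingWeight m v i j * w ^ j) := by
    rcases eq_or_ne i j with rfl | hne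
    · simp only [if_true, crossingWeight_self hm]
      ring
    · simp only [if_neg hne, if_neg hne.symm]
      ring
  rw [he, norm_mul, norm_mul, norm_pow, Real.norm_of_nonneg hw.1, Real.norm_eq_abs,
    Real.norm_eq_abs]
  calc _ ≤ ((j + 3) ^ 3 * (∑' l, |b l|) ^ 2 * h ^ 2) * (1 * r ^ j) := by
        refine mul_le_mul (abs_transition_sub_sub_le hb hp hf hh i j)
          (mul_le_mul (abs_crossingWeight_le m hv i j) (pow_le_pow_left₀ hw.1 hw.2 j)
            (pow_nonneg hw.1 j) zero_le_one) (mul_nonneg (abs_nonneg _) (pow_nonneg hw.1 j)) ?_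
        positivity
    _ = _ := by ring

theorem SolvesOn.exists_abs_pow_sub_le (hb : IsBranchingRates b) (m : ℕ) {v : ℝ}
    (hv : v ∈ Icc (0 : ℝ) 1) {r T : ℝ} (h0 : 0 ≤ r) (h1 : r < 1) {y : ℝ → ℝ}
    (hy : SolvesOn (crossingField b m v) T y) (hyr : ∀ t ∈ Icc 0 T, y t ∈ Icc 0 r) :
    ∃ C, ∀ (i : ℕ) (s h : ℝ), 0 ≤ s → 0 ≤ h → s + h ≤ T →
      |y (s + h) ^ i - y s ^ i - h * (i * y s ^ (i - 1) * crossingField b m v (y s))| ≤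
        C * h ^ 2 := by
  obtain ⟨L, hL0, hL⟩ := exists_lipschitz_mul_pow_mul_crossingField hb m hv h0 h1
  obtain ⟨M, hM⟩ := isCompact_Icc.exists_bound_of_continuousOn
    ((hb.continuousOn_crossingField m v).mono (Icc_subset_Icc_right h1.le))
  refine ⟨L * M, fun i s h hs hh hsh => ?_⟩
  have hmem : ∀ τ ∈ Icc 0 h, s + τ ∈ Icc 0 T := fun τ hτ =>
    ⟨by linarith [hτ.1], by linarith [hτ.2]⟩
  have hyabs : ∀ t ∈ Icc 0 T, |y t| ≤ r := fun t ht => by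
    rw [abs_of_nonneg (hyr t ht).1]
    exact (hyr t ht).2
  have hz : SolvesOn (crossingField b m v) h fun τ => y (s + τ) := by
    have := (hy.shift hs).mono (T' := h) (by linarith)
    simpa only [add_comm s] using this
  have hlip : ∀ τ ∈ Icc 0 h, |y (s + τ) - y s| ≤ M * τ := fun τ hτ => by
    simpa using norm_image_sub_le_of_norm_deriv_right_le_segment hz.continuousOn hz.deriv
      (fun x hx => hM _ (hyr _ (hmem x (Ico_subset_Icc_self hx)))) τ hτ
  have hM0 : 0 ≤ M := (norm_nonneg _).trans (hM 0 ⟨le_rfl, h0⟩)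
  set q := (i : ℝ) * y s ^ (i - 1) * crossingField b m v (y s) with hq
  have hd : ∀ τ ∈ Ico 0 h, HasDerivWithinAt (fun τ => y (s + τ) ^ i - τ * q)
      (i * y (s + τ) ^ (i - 1) * crossingField b m v (y (s + τ)) - q) (Ici τ) τ := fun τ hτ =>
    ((hz.deriv τ hτ).pow i).sub (by
      simpa using (hasDerivWithinAt_id τ (Ici τ)).mul_const q)
  have := norm_image_sub_le_of_norm_deriv_right_le_segment
    (f := fun τ => y (s + τ) ^ i - τ * q) (C := L * (M * h))
    ((hz.continuousOn.pow i).sub (by fun_prop)) hd (fun τ hτ => ?_) h ⟨hh, le_rfl⟩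
  · simp only [add_zero, zero_mul, sub_zero, Real.norm_eq_abs] at this
    rw [sub_right_comm]
    exact this.trans_eq (by ring)
  · have hτ' := Ico_subset_Icc_self hτ
    refine (hL i _ _ (hyabs _ (hmem τ hτ')) (hyabs s ⟨hs, by linarith⟩)).trans ?_
    gcongr
    exact (hlip τ hτ').trans (by gcongr; exact hτ.2.le)

/-- The weighted mean of y(s)^j and the power y(s+h)^i have the same expansion y(s)^i + h i
y(s)^(i-1) f(y(s)) up to O(h²), so their difference is O(h²). -/
theorem SolvesOn.exists_abs_tsum_sub_le (hb : IsBranchingRates b) (hp : IsTransitionFunction p)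
    (hf : ForwardEquation b p) {m : ℕ} (hm : m ≠ 1) {v : ℝ} (hv : v ∈ Icc (0 : ℝ) 1) {r T : ℝ}
    (h0 : 0 ≤ r) (h1 : r < 1) {y : ℝ → ℝ} (hy : SolvesOn (crossingField b m v) T y)
    (hyr : ∀ t ∈ Icc 0 T, y t ∈ Icc 0 r) :
    ∃ C, ∀ (i : ℕ) (s h : ℝ), 0 ≤ s → 0 ≤ h → s + h ≤ T →
      |∑' j, p h i j * (crossingWeight m v i j * y s ^ j - y (s + h) ^ i)| ≤ C * h ^ 2 := by
  obtain ⟨C, hC⟩ := hy.exists_abs_pow_sub_le hb m hv h0 h1 hyr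
  refine ⟨(∑' l, |b l|) ^ 2 * (∑' j : ℕ, ((j : ℝ) + 3) ^ 3 * r ^ j) + C,
    fun i s h hs hh hsh => ?_⟩
  have hw := hyr s ⟨hs, by linarith⟩
  have hsum : Summable fun j => p h i j * (crossingWeight m v i j * y s ^ j) := by
    refine Summable.of_norm_bounded (hp.hasSum_one h hh i).summable fun j => ?_
    rw [norm_mul, Real.norm_of_nonneg (hp.nonneg h hh i j), norm_mul, norm_pow,
      Real.norm_of_nonneg hw.1]
    exact mul_le_of_le_one_right (hp.nonneg h hh i j) (mul_le_one₀ (abs_crossingWeight_le m hv i j)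
      (pow_nonneg hw.1 j) (pow_le_one₀ hw.1 (hw.2.trans h1.le)))
  have he := (hsum.hasSum.sub ((hp.hasSum_one h hh i).mul_right (y (s + h) ^ i))).tsum_eq
  simp only [← mul_sub, one_mul] at he
  rw [he]
  have h2 := abs_tsum_transition_sub_le hb hp hf hm hv h1 hw hh i
  have h3 := hC i s h hs hh hsh
  rw [abs_le] at h2 h3 ⊢
  constructor <;> linarith [h2.1, h2.2, h3.1, h3.2]

end

/-! ### The joint generating function as a limit over grids. -/

theorem measurable_gridCount {Ω : Type*} [MeasurableSpace Ω] {X : ℝ≥0 → Ω → ℕ}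
    (hX : ∀ t, Measurable (X t)) (m : ℕ) (h : ℝ≥0) (k : ℕ) :
    Measurable fun ω => gridCount (fun s => X s ω) m h k := by
  obtain ⟨N, hN⟩ := exists_gridCount_eq_comp_gridHistory X m h k
  simp only [hN]
  exact (measurable_of_countable N).comp (measurable_gridHistory hX h k)

theorem measurable_pow_mul_pow {Ω : Type*} [MeasurableSpace Ω] {K L : Ω → ℕ}
    (hK : Measurable K) (hL : Measurable L) (u v : ℝ) :
    Measurable fun ω => u ^ K ω * v ^ L ω :=
  (measurable_of_countable fun kl : ℕ × ℕ => u ^ kl.1 * v ^ kl.2).comp (hK.prodMk hL)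

theorem ae_eventually_gridCount {b : ℕ → ℝ} {Ω : Type*} [MeasurableSpace Ω]
    {μ : Measure Ω} {X : ℝ≥0 → Ω → ℕ} {m : ℕ} (hX : IsMarkovBranchingProcess b μ X) (hm : m ≠ 1)
    (t : ℝ≥0) :
    ∀ᵐ ω ∂μ, ∀ᶠ n : ℕ in atTop,
      gridCount (fun s => X s ω) m (t / n) n = crossingNumber (fun s => X s ω) m t := by
  filter_upwards [hX.step_paths] with ω hω using hω.tendsto_gridCount hm t

theorem aestronglyMeasurable_pow_mul_pow {b : ℕ → ℝ} {Ω : Type*} [MeasurableSpace Ω]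
    {μ : Measure Ω} {X : ℝ≥0 → Ω → ℕ} {m : ℕ} (hX : IsMarkovBranchingProcess b μ X) (hm : m ≠ 1)
    (t : ℝ≥0) (u v : ℝ) :
    AEStronglyMeasurable (fun ω => u ^ X t ω * v ^ crossingNumber (fun s => X s ω) m t) μ := by
  refine aestronglyMeasurable_of_tendsto_ae atTop
    (f := fun n : ℕ => fun ω => u ^ X t ω * v ^ gridCount (fun s => X s ω) m (t / n) n)
    (fun n => (measurable_pow_mul_pow (hX.measurable t)
      (measurable_gridCount hX.measurable m _ n) u v).aestronglyMeasurable) ?_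
  filter_upwards [ae_eventually_gridCount hX hm t] with ω hω
  exact tendsto_const_nhds.congr' (hω.mono fun n hn => by simp only [hn])

section

variable {b : ℕ → ℝ} {Ω : Type*} [MeasurableSpace Ω] {μ : Measure Ω} [IsProbabilityMeasure μ]
  {X : ℝ≥0 → Ω → ℕ} {m : ℕ} {u v : ℝ}

theorem pow_mul_pow_mem_Icc (hu : u ∈ Icc (0 : ℝ) 1) (hv : v ∈ Icc (0 : ℝ) 1) (k l : ℕ) :
    u ^ k * v ^ l ∈ Icc (0 : ℝ) 1 :=
  ⟨mul_nonneg (pow_nonneg hu.1 k) (pow_nonneg hv.1 l),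
    mul_le_one₀ (pow_le_one₀ hu.1 hu.2) (pow_nonneg hv.1 l) (pow_le_one₀ hv.1 hv.2)⟩

theorem norm_pow_mul_pow_le (hu : u ∈ Icc (0 : ℝ) 1) (hv : v ∈ Icc (0 : ℝ) 1) (k l : ℕ) :
    ‖u ^ k * v ^ l‖ ≤ 1 := by
  rw [Real.norm_of_nonneg (pow_mul_pow_mem_Icc hu hv k l).1]
  exact (pow_mul_pow_mem_Icc hu hv k l).2

/-- The joint generating function `E[u^X(t) v^Y_m(t)]`. -/
noncomputable def jointGF (μ : Measure Ω) (X : ℝ≥0 → Ω → ℕ) (m : ℕ) (t u v : ℝ) : ℝ :=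
  ∫ ω, u ^ X t.toNNReal ω * v ^ crossingNumber (fun s => X s ω) m t.toNNReal ∂μ

theorem integrable_pow_mul_pow (hX : IsMarkovBranchingProcess b μ X) (hm : m ≠ 1)
    (hu : u ∈ Icc (0 : ℝ) 1) (hv : v ∈ Icc (0 : ℝ) 1) (t : ℝ≥0) :
    Integrable (fun ω => u ^ X t ω * v ^ crossingNumber (fun s => X s ω) m t) μ :=
  Integrable.of_bound (aestronglyMeasurable_pow_mul_pow hX hm t u v) 1
    (Eventually.of_forall fun _ => norm_pow_mul_pow_le hu hv _ _)

theorem jointGF_mem_Icc (hX : IsMarkovBranchingProcess b μ X) (hm : m ≠ 1)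
    (hu : u ∈ Icc (0 : ℝ) 1) (hv : v ∈ Icc (0 : ℝ) 1) (t : ℝ) :
    jointGF μ X m t u v ∈ Icc (0 : ℝ) 1 := by
  refine ⟨integral_nonneg fun ω => (pow_mul_pow_mem_Icc hu hv _ _).1, ?_⟩
  have := integral_mono (integrable_pow_mul_pow hX hm hu hv t.toNNReal) (integrable_const (1 : ℝ))
    (fun ω => (pow_mul_pow_mem_Icc hu hv _ _).2)
  simpa [jointGF] using this

theorem jointGF_mono (hX : IsMarkovBranchingProcess b μ X) (hm : m ≠ 1) {u' : ℝ}
    (hu : u ∈ Icc (0 : ℝ) 1) (hu' : u' ∈ Icc (0 : ℝ) 1) (huu : u ≤ u') (hv : v ∈ Icc (0 : ℝ) 1)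
    (t : ℝ) : jointGF μ X m t u v ≤ jointGF μ X m t u' v := by
  refine integral_mono (integrable_pow_mul_pow hX hm hu hv _)
    (integrable_pow_mul_pow hX hm hu' hv _) fun ω => ?_
  exact mul_le_mul_of_nonneg_right (pow_le_pow_left₀ hu.1 huu _) (pow_nonneg hv.1 _)

theorem tendsto_jointGF_one (hX : IsMarkovBranchingProcess b μ X) (hm : m ≠ 1)
    (hv : v ∈ Icc (0 : ℝ) 1) (t : ℝ) :
    Tendsto (fun u => jointGF μ X m t u v) (𝓝[<] 1) (𝓝 (jointGF μ X m t 1 v)) := by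
  refine tendsto_integral_filter_of_dominated_convergence (fun _ => 1)
    (Eventually.of_forall fun u => aestronglyMeasurable_pow_mul_pow hX hm _ u v) ?_
    (integrable_const _) (Eventually.of_forall fun ω => ?_)
  · filter_upwards [Ico_mem_nhdsLT (zero_lt_one (α := ℝ))] with u hu
    exact Eventually.of_forall fun _ => norm_pow_mul_pow_le (Ico_subset_Icc_self hu) hv _ _
  · have : Continuous fun u : ℝ => u ^ X t.toNNReal ω *
        v ^ crossingNumber (fun s => X s ω) m t.toNNReal := by fun_prop
    exact (this.tendsto 1).mono_left nhdsWithin_le_nhds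

theorem abs_integral_gridCount_sub_le (hX : IsMarkovBranchingProcess b μ X)
    (hX0 : ∀ᵐ ω ∂μ, X 0 ω = 1) {p : ℝ → ℕ → ℕ → ℝ} (hp : IsTransitionFunction p)
    (hM : HasTransition μ X p) (hv : v ∈ Icc (0 : ℝ) 1) {T C : ℝ} {y : ℝ → ℝ}
    (hyr : ∀ t ∈ Icc 0 T, y t ∈ Icc (0 : ℝ) 1)
    (hC : ∀ (i : ℕ) (s h : ℝ), 0 ≤ s → 0 ≤ h → s + h ≤ T →
      |∑' j, p h i j * (crossingWeight m v i j * y s ^ j - y (s + h) ^ i)| ≤ C * h ^ 2)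
    (h : ℝ≥0) (n : ℕ) (hn : n * (h : ℝ) = T) :
    |∫ ω, y 0 ^ X (n * h) ω * v ^ gridCount (fun s => X s ω) m h n ∂μ - y T| ≤
      n * (C * (h : ℝ) ^ 2) := by
  -- D interpolates between y(T), at k = 0, and the grid expectation at k = n; the solution runs
  -- backwards while the process runs forwards.
  set D : ℕ → ℝ := fun k => ∫ ω, y (T - k * h) ^ X (k * h) ω *
    v ^ gridCount (fun s => X s ω) m h k ∂μ with hD
  have hmem : ∀ k ≤ n, T - k * h ∈ Icc 0 T := by
    intro k hk
    have : (k : ℝ) * h ≤ n * h := by gcongr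
    have : (0 : ℝ) ≤ k * h := by positivity
    exact ⟨by linarith, by linarith⟩
  have hD0 : D 0 = y T := by
    have : D 0 = ∫ ω, y T ∂μ := by
      refine integral_congr_ae ?_
      filter_upwards [hX0] with ω hω
      simp [gridCount, hω]
    simpa using this
  have hDn : D n = ∫ ω, y 0 ^ X (n * h) ω * v ^ gridCount (fun s => X s ω) m h n ∂μ := by
    simp only [hD, hn, sub_self]
  have hint : ∀ k ≤ n, Integrable (fun ω => y (T - k * h) ^ X (k * h) ω *
      v ^ gridCount (fun s => X s ω) m h k) μ := fun k hk =>
    Integrable.of_bound (measurable_pow_mul_pow (hX.measurable _)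
      (measurable_gridCount hX.measurable m h k) _ v).aestronglyMeasurable 1
      (Eventually.of_forall fun _ => norm_pow_mul_pow_le (hyr _ (hmem k hk)) hv _ _)
  have hstep : ∀ k < n, dist (D k) (D (k + 1)) ≤ C * (h : ℝ) ^ 2 := by
    intro k hk
    obtain ⟨N, hN⟩ := exists_gridCount_eq_comp_gridHistory X m h k
    set s := T - (k + 1 : ℕ) * (h : ℝ) with hs
    have hsk : T - k * h = s + h := by
      rw [hs]
      push_cast
      ring
    have hs1 := hmem (k + 1) hk
    have hs0 := hmem k hk.le
    rw [hsk] at hs0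
    have hy1 := hyr s hs1
    have hy0 := hyr (s + h) hs0
    have hbound : ∀ i j, |crossingWeight m v i j * y s ^ j - y (s + h) ^ i| ≤ 1 + 1 := by
      intro i j
      refine (abs_sub _ _).trans (add_le_add ?_ ?_)
      · rw [abs_mul, abs_pow, abs_of_nonneg hy1.1]
        exact mul_le_one₀ (abs_crossingWeight_le m hv i j) (pow_nonneg hy1.1 j)
          (pow_le_one₀ hy1.1 hy1.2)
      · rw [abs_pow, abs_of_nonneg hy0.1]
        exact pow_le_one₀ hy0.1 hy0.2
    have key := abs_integral_gridHistory_mul_le hX.measurable hp hM h k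
      (F := fun a => v ^ N a)
      (fun a => by
        rw [abs_pow, abs_of_nonneg hv.1]
        exact pow_le_one₀ hv.1 hv.2)
      hbound (fun i => hC i s h hs1.1 h.2 hs0.2)
    rw [dist_comm, Real.dist_eq, hD]
    simp only
    rw [← integral_sub (hint (k + 1) hk) (hint k hk.le)]
    refine le_of_eq_of_le (congrArg abs (integral_congr_ae (Eventually.of_forall fun ω => ?_))) key
    simp only [← hN, hsk]
    have hw : v ^ gridCount (fun s => X s ω) m h (k + 1) = v ^ gridCount (fun s => X s ω) m h k *
        crossingWeight m v (X (k * h) ω) (X ((k + 1 : ℕ) * h) ω) := by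
      simp only [gridCount, Finset.sum_range_succ, pow_add, crossingWeight]
      congr 1
      split_ifs <;> simp
    rw [hw, ← hs]
    ring
  have := dist_le_range_sum_of_dist_le n (fun {k} hk => hstep k hk)
  rw [← hDn, ← hD0, ← Real.dist_eq, dist_comm]
  simpa using this

theorem jointGF_eq_of_solvesOn (hb : IsBranchingRates b) (hX : IsMarkovBranchingProcess b μ X)
    (hX0 : ∀ᵐ ω ∂μ, X 0 ω = 1) (hm : m ≠ 1) (hv : v ∈ Icc (0 : ℝ) 1) {T r : ℝ} {y : ℝ → ℝ}
    (h0 : 0 ≤ r) (h1 : r < 1) (hT : 0 ≤ T) (hy : SolvesOn (crossingField b m v) T y)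
    (hyr : ∀ t ∈ Icc 0 T, y t ∈ Icc 0 r) : jointGF μ X m T (y 0) v = y T := by
  obtain ⟨p, hp, hf, hM⟩ := hX.markov
  obtain ⟨C, hC⟩ := hy.exists_abs_tsum_sub_le hb hp hf hm hv h0 h1 hyr
  have hyr' : ∀ t ∈ Icc 0 T, y t ∈ Icc (0 : ℝ) 1 := fun t ht =>
    Icc_subset_Icc_right h1.le (hyr t ht)
  have hu := hyr' 0 ⟨le_rfl, hT⟩
  lift T to ℝ≥0 using hT
  have hlim1 : Tendsto (fun n : ℕ => ∫ ω, y 0 ^ X T ω *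
      v ^ gridCount (fun s => X s ω) m (T / n) n ∂μ) atTop (𝓝 (jointGF μ X m T (y 0) v)) := by
    rw [jointGF, Real.toNNReal_coe]
    refine tendsto_integral_of_dominated_convergence (fun _ => 1)
      (fun n => (measurable_pow_mul_pow (hX.measurable T)
        (measurable_gridCount hX.measurable m _ n) _ v).aestronglyMeasurable)
      (integrable_const _)
      (fun n => Eventually.of_forall fun _ => norm_pow_mul_pow_le hu hv _ _) ?_
    filter_upwards [ae_eventually_gridCount hX hm T] with ω hω
    exact tendsto_const_nhds.congr' (hω.mono fun n hn => by simp only [hn])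
  have hlim2 : Tendsto (fun n : ℕ => ∫ ω, y 0 ^ X T ω *
      v ^ gridCount (fun s => X s ω) m (T / n) n ∂μ) atTop (𝓝 (y T)) := by
    rw [tendsto_iff_dist_tendsto_zero]
    -- The n errors C (T/n)² add up to C T²/n.
    refine squeeze_zero' (Eventually.of_forall fun _ => dist_nonneg) ?_
      (tendsto_const_div_atTop_nhds_zero_nat (C * (T : ℝ) ^ 2))
    filter_upwards [eventually_gt_atTop 0] with n hn
    have hn' : (n : ℝ≥0) * (T / n) = T := mul_div_cancel₀ _ (by positivity)
    have := abs_integral_gridCount_sub_le hX hX0 hp hM hv hyr' hC (T / n) n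
      (by exact_mod_cast hn')
    rw [hn'] at this
    rw [Real.dist_eq]
    refine this.trans_eq ?_
    push_cast
    field_simp
  exact tendsto_nhds_unique hlim1 hlim2

/-! ### The generating function solves the initial value problem. -/

theorem solvesOn_jointGF (hb : IsBranchingRates b) (hX : IsMarkovBranchingProcess b μ X)
    (hX0 : ∀ᵐ ω ∂μ, X 0 ω = 1) (hm : 1 < m) (hu : u ∈ Ico (0 : ℝ) 1) (hv : v ∈ Icc (0 : ℝ) 1)
    (T : ℝ) : SolvesOn (crossingField b m v) T (fun t => jointGF μ X m t u v) := by
  rcases lt_or_ge T 0 with hT | hT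
  · exact ⟨by simp [Icc_eq_empty hT.not_ge], fun t ht => absurd (ht.1.trans_lt ht.2) hT.not_gt⟩
  obtain ⟨y, r, h0, h1, hyu, hy, hyr⟩ := exists_solvesOn hb hm hv hu hT
  have heq : ∀ t ∈ Icc 0 T, jointGF μ X m t u v = y t := fun t ht => by
    rw [← hyu]
    exact jointGF_eq_of_solvesOn hb hX hX0 (by omega) hv h0 h1 ht.1 (hy.mono ht.2)
      fun s hs => hyr s ⟨hs.1, hs.2.trans ht.2⟩
  refine ⟨hy.continuousOn.congr heq, fun t ht => ?_⟩
  rw [heq t (Ico_subset_Icc_self ht)]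
  refine (hy.deriv t ht).congr_of_eventuallyEq ?_ (heq t (Ico_subset_Icc_self ht))
  filter_upwards [Ico_mem_nhdsGE ht.2] with s hs using heq s ⟨ht.1.trans hs.1, hs.2.le⟩

theorem jointGF_zero (hX0 : ∀ᵐ ω ∂μ, X 0 ω = 1) : jointGF μ X m 0 u v = u := by
  have : jointGF μ X m 0 u v = ∫ ω, u ∂μ := by
    refine integral_congr_ae ?_
    filter_upwards [hX0] with ω hω
    simp [crossingNumber_zero, hω]
  simpa using this

theorem SolvesOn.integral_eq (hb : IsBranchingRates b) {T : ℝ} {y : ℝ → ℝ}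
    (hy : SolvesOn (crossingField b m v) T y) (hyr : ∀ t ∈ Icc 0 T, y t ∈ Icc (0 : ℝ) 1)
    {s t : ℝ} (hs : 0 ≤ s) (hst : s ≤ t) (ht : t ≤ T) :
    ∫ τ in s..t, crossingField b m v (y τ) = y t - y s := by
  have hsub : Icc s t ⊆ Icc 0 T := Icc_subset_Icc hs ht
  refine intervalIntegral.integral_eq_sub_of_hasDeriv_right_of_le hst (hy.continuousOn.mono hsub)
    (fun τ hτ => (hy.deriv τ ⟨hs.trans hτ.1.le, hτ.2.trans_le ht⟩).mono Ioi_subset_Ici_self) ?_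
  refine ContinuousOn.intervalIntegrable ?_
  rw [uIcc_of_le hst]
  exact (hb.continuousOn_crossingField m v).comp (hy.continuousOn.mono hsub)
    fun τ hτ => hyr τ (hsub hτ)

theorem isSolution_of_integral_eq (hb : IsBranchingRates b) {y : ℝ → ℝ}
    (hc : ContinuousOn y (Ici 0)) (hyr : ∀ t, 0 ≤ t → y t ∈ Icc (0 : ℝ) 1)
    (hi : ∀ t, 0 ≤ t → ∫ τ in 0..t, crossingField b m v (y τ) = y t - u) :
    IsSolution b m u v y := by
  refine ⟨?_, fun t ht => hb.summable_mul_pow ?_, fun t ht => ?_⟩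
  · have := hi 0 le_rfl
    rw [intervalIntegral.integral_same] at this
    linarith
  · rw [abs_of_nonneg (hyr t ht).1]
    exact (hyr t ht).2
  -- Replacing τ by max(τ,0) extends the integrand continuously to ℝ, so that the fundamental
  -- theorem of calculus also applies at 0.
  · have hF : Continuous fun τ => crossingField b m v (y (max τ 0)) :=
      ((hb.continuousOn_crossingField m v).comp hc hyr).comp_continuous
        (f := fun τ : ℝ => max τ 0) (by fun_prop) fun τ => mem_Ici.2 (le_max_right _ _)
    have hd := ((intervalIntegral.integral_hasDerivAt_right (hF.intervalIntegrable 0 t)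
      (hF.stronglyMeasurableAtFilter _ _) hF.continuousAt).const_add u).hasDerivWithinAt
      (s := Ici 0)
    rw [max_eq_left ht] at hd
    have heq : ∀ s ∈ Ici (0 : ℝ), y s = u + ∫ τ in 0..s, crossingField b m v (y (max τ 0)) := by
      intro s hs
      have : ∫ τ in 0..s, crossingField b m v (y (max τ 0)) =
          ∫ τ in 0..s, crossingField b m v (y τ) := by
        refine intervalIntegral.integral_congr fun τ hτ => ?_
        rw [uIcc_of_le hs] at hτ
        simp only [max_eq_left hτ.1]
      rw [this, hi s hs]
      ring
    exact hd.congr heq (heq t ht)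

theorem continuousOn_Ici_of_solvesOn {f y : ℝ → ℝ} (h : ∀ T, SolvesOn f T y) :
    ContinuousOn y (Ici 0) := by
  intro t ht
  refine ((h (t + 1)).continuousOn t ⟨ht, by linarith⟩).mono_of_mem_nhdsWithin ?_
  filter_upwards [self_mem_nhdsWithin, mem_nhdsWithin_of_mem_nhds (Iio_mem_nhds (lt_add_one t))]
    with s hs hs' using ⟨hs, le_of_lt hs'⟩

theorem isSolution_jointGF_of_lt_one (hb : IsBranchingRates b)
    (hX : IsMarkovBranchingProcess b μ X) (hX0 : ∀ᵐ ω ∂μ, X 0 ω = 1) (hm : 1 < m)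
    (hu : u ∈ Ico (0 : ℝ) 1) (hv : v ∈ Icc (0 : ℝ) 1) :
    IsSolution b m u v (fun t => jointGF μ X m t u v) := by
  have hs := solvesOn_jointGF hb hX hX0 hm hu hv
  have hr := jointGF_mem_Icc hX hm.ne' (Ico_subset_Icc_self hu) hv
  refine isSolution_of_integral_eq hb (continuousOn_Ici_of_solvesOn hs) (fun t _ => hr t)
    fun t ht => ?_
  rw [(hs t).integral_eq hb (fun t _ => hr t) le_rfl ht le_rfl, jointGF_zero hX0]

/-- The integral equation survives u ↑ 1 by dominated convergence, as f is continuous and bounded on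
[0,1]. Continuity in t survives because the Lipschitz constant M = sup |f| is uniform in u. -/
theorem isSolution_jointGF_one (hb : IsBranchingRates b) (hX : IsMarkovBranchingProcess b μ X)
    (hX0 : ∀ᵐ ω ∂μ, X 0 ω = 1) (hm : 1 < m) (hv : v ∈ Icc (0 : ℝ) 1) :
    IsSolution b m 1 v (fun t => jointGF μ X m t 1 v) := by
  obtain ⟨M, hM⟩ := isCompact_Icc.exists_bound_of_continuousOn (hb.continuousOn_crossingField m v)
  have hr : ∀ {u}, u ∈ Icc (0 : ℝ) 1 → ∀ t, jointGF μ X m t u v ∈ Icc (0 : ℝ) 1 := fun hu =>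
    jointGF_mem_Icc hX hm.ne' hu hv
  have hM0 : 0 ≤ M := (norm_nonneg _).trans (hM 0 ⟨le_rfl, zero_le_one⟩)
  have hev : ∀ᶠ u in 𝓝[<] (1 : ℝ), u ∈ Ico (0 : ℝ) 1 := Ico_mem_nhdsLT zero_lt_one
  have hlim := tendsto_jointGF_one (m := m) hX hm.ne' hv
  have hc : ContinuousOn (fun t => jointGF μ X m t 1 v) (Ici 0) := by
    have hle : ∀ s t, 0 ≤ s → s ≤ t →
        |jointGF μ X m t 1 v - jointGF μ X m s 1 v| ≤ M * |t - s| := by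
      intro s t hs hst
      refine le_of_tendsto ((hlim t).sub (hlim s)).abs ?_
      filter_upwards [hev] with u hu
      have hu' := Ico_subset_Icc_self hu
      rw [← (solvesOn_jointGF hb hX hX0 hm hu hv t).integral_eq hb (fun t _ => hr hu' t) hs hst
        le_rfl]
      exact intervalIntegral.norm_integral_le_of_norm_le_const fun τ _ => hM _ (hr hu' τ)
    refine (LipschitzOnWith.of_dist_le_mul (K := ⟨M, hM0⟩) fun s hs t ht => ?_).continuousOn
    rw [Real.dist_eq, Real.dist_eq]
    rcases le_total s t with hst | hst
    · rw [abs_sub_comm, abs_sub_comm s]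
      exact hle s t hs hst
    · exact hle t s ht hst
  refine isSolution_of_integral_eq hb hc (fun t _ => hr ⟨zero_le_one, le_rfl⟩ t) fun t ht => ?_
  have hlimI : Tendsto (fun u => ∫ τ in 0..t, crossingField b m v (jointGF μ X m τ u v))
      (𝓝[<] 1) (𝓝 (∫ τ in 0..t, crossingField b m v (jointGF μ X m τ 1 v))) := by
    refine intervalIntegral.tendsto_integral_filter_of_dominated_convergence (fun _ => M) ?_ ?_
      intervalIntegrable_const (Eventually.of_forall fun τ _ => ?_)
    · filter_upwards [hev] with u hu
      have hu' := Ico_subset_Icc_self hu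
      have hcu : ContinuousOn (fun τ => crossingField b m v (jointGF μ X m τ u v)) (Ici 0) :=
        (hb.continuousOn_crossingField m v).comp
          (continuousOn_Ici_of_solvesOn (solvesOn_jointGF hb hX hX0 hm hu hv))
          fun τ _ => hr hu' τ
      refine (hcu.mono ?_).aestronglyMeasurable measurableSet_uIoc
      rw [uIoc_of_le ht]
      exact fun τ hτ => hτ.1.le
    · filter_upwards [hev] with u hu
      exact Eventually.of_forall fun τ _ => hM _ (hr (Ico_subset_Icc_self hu) τ)
    · refine ((hb.continuousOn_crossingField m v) _ (hr ⟨zero_le_one, le_rfl⟩ τ)).tendsto.comp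
        (tendsto_nhdsWithin_iff.2 ⟨hlim τ, ?_⟩)
      filter_upwards [hev] with u hu using hr (Ico_subset_Icc_self hu) τ
  refine tendsto_nhds_unique hlimI ?_
  have : Tendsto (fun u : ℝ => u) (𝓝[<] 1) (𝓝 1) := tendsto_id.mono_left nhdsWithin_le_nhds
  refine ((hlim t).sub this).congr' ?_
  filter_upwards [hev] with u hu
  rw [(solvesOn_jointGF hb hX hX0 hm hu hv t).integral_eq hb
    (fun t _ => hr (Ico_subset_Icc_self hu) t) le_rfl ht le_rfl, jointGF_zero hX0]

/-! ### Uniqueness, including the initial value 1. -/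

theorem IsSolution.eq_jointGF_of_lt_one (hb : IsBranchingRates b)
    (hX : IsMarkovBranchingProcess b μ X) (hX0 : ∀ᵐ ω ∂μ, X 0 ω = 1) (hm : 1 < m)
    (hu : u ∈ Ico (0 : ℝ) 1) (hv : v ∈ Icc (0 : ℝ) 1) {y : ℝ → ℝ} (hy : IsSolution b m u v y)
    {t : ℝ} (ht : 0 ≤ t) : y t = jointGF μ X m t u v :=
  (hy.solvesOn t).eqOn hb hm hv (solvesOn_jointGF hb hX hX0 hm hu hv t)
    (fun _ hs => hy.mem_Icc hb hm hv (Ico_subset_Icc_self hu) hs.1)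
    (fun s _ => jointGF_mem_Icc hX hm.ne' (Ico_subset_Icc_self hu) hv s)
    (by rw [hy.init]; exact hu.2) (by rw [hy.init, jointGF_zero hX0]) ⟨ht, le_rfl⟩

/-- If y fell below the solution z from some u < 1, the two would meet at a time s with z(s) < 1,
and uniqueness below 1 would make them agree from then on. -/
theorem IsSolution.jointGF_le (hb : IsBranchingRates b) (hX : IsMarkovBranchingProcess b μ X)
    (hX0 : ∀ᵐ ω ∂μ, X 0 ω = 1) (hm : 1 < m) (hv : v ∈ Icc (0 : ℝ) 1) {y : ℝ → ℝ}
    (hy : IsSolution b m 1 v y) {t : ℝ} (ht : 0 ≤ t) : jointGF μ X m t 1 v ≤ y t := by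
  refine le_of_tendsto (tendsto_jointGF_one hX hm.ne' hv t) ?_
  filter_upwards [Ico_mem_nhdsLT (zero_lt_one (α := ℝ))] with u hu
  by_contra! hlt
  set z : ℝ → ℝ := fun t => jointGF μ X m t u v with hz
  have hzs := solvesOn_jointGF hb hX hX0 hm hu hv t
  have hzr : ∀ t, z t ∈ Icc (0 : ℝ) 1 := jointGF_mem_Icc hX hm.ne' (Ico_subset_Icc_self hu) hv
  have hyr : ∀ t, 0 ≤ t → y t ∈ Icc (0 : ℝ) 1 := fun t ht =>
    hy.mem_Icc hb hm hv ⟨zero_le_one, le_rfl⟩ ht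
  have hz0 : z 0 = u := jointGF_zero hX0
  obtain ⟨s, hs, hs0⟩ := intermediate_value_Icc' ht
    ((hy.solvesOn t).continuousOn.sub hzs.continuousOn) (show (0 : ℝ) ∈ Icc _ _ from
      ⟨by simp only [Pi.sub_apply]; exact (sub_neg.2 hlt).le, by
        change 0 ≤ y 0 - z 0
        rw [hz0, hy.init]
        linarith [hu.2]⟩)
  have hs0' : y s = z s := sub_eq_zero.1 hs0
  have hz1 : z s < 1 := hzs.lt_one hb hm hv (fun t _ => hzr t) (hz0.trans_lt hu.2) s hs
  have := ((hy.solvesOn t).shift hs.1).eqOn hb hm hv (hzs.shift hs.1)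
    (fun τ hτ => hyr _ (by linarith [hτ.1, hs.1])) (fun τ _ => hzr _)
    (by simpa [hs0'] using hz1) (by simpa using hs0')
    (show t - s ∈ Icc 0 (t - s) from ⟨by linarith [hs.2], le_rfl⟩)
  simp only [sub_add_cancel] at this
  exact hlt.ne this

/-- The initial slope is f(1) < 0, so y(s) < 1 for small s > 0. By uniqueness below 1, y(t+s) is the
generating function at time t and argument y(s), hence at most its value at argument 1; then s ↓ 0.
-/
theorem IsSolution.le_jointGF (hb : IsBranchingRates b) (hX : IsMarkovBranchingProcess b μ X)
    (hX0 : ∀ᵐ ω ∂μ, X 0 ω = 1) (hm : 1 < m) (hv : v ∈ Icc (0 : ℝ) 1) (hneg : 0 < b m * (1 - v))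
    {y : ℝ → ℝ} (hy : IsSolution b m 1 v y) {t : ℝ} (ht : 0 ≤ t) :
    y t ≤ jointGF μ X m t 1 v := by
  have h11 : (1 : ℝ) ∈ Icc (0 : ℝ) 1 := ⟨zero_le_one, le_rfl⟩
  have hd : HasDerivWithinAt y (-(b m * (1 - v))) (Ici 0) 0 := by
    have := hy.deriv 0 le_rfl
    rwa [hy.init, ← crossingField, hb.crossingField_one] at this
  have hslope := (hasDerivWithinAt_iff_tendsto_slope' (by simp)).1 hd.Ioi_of_Ici
  have hlt : ∀ᶠ s in 𝓝[>] (0 : ℝ), y s < 1 := by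
    filter_upwards [hslope.eventually_lt_const (neg_lt_zero.2 hneg), self_mem_nhdsWithin]
      with s hs hs0
    rw [slope_def_field, hy.init, sub_zero, div_lt_iff₀ hs0] at hs
    linarith
  have hcont : Tendsto (fun s => y (t + s)) (𝓝[>] 0) (𝓝 (y t)) := by
    have h1 : Tendsto (fun s : ℝ => t + s) (𝓝[>] 0) (𝓝[Ici 0] t) := by
      refine tendsto_nhdsWithin_iff.2 ⟨?_, ?_⟩
      · have : Continuous fun s : ℝ => t + s := by fun_prop
        simpa using (this.tendsto 0).mono_left (nhdsWithin_le_nhds (s := Ioi 0))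
      · filter_upwards [self_mem_nhdsWithin] with s hs
        exact add_nonneg ht (le_of_lt hs)
    exact (hy.deriv t ht).continuousWithinAt.tendsto.comp h1
  refine le_of_tendsto hcont ?_
  filter_upwards [hlt, self_mem_nhdsWithin] with s hs1 hs0
  have hs0' : 0 ≤ s := le_of_lt hs0
  have hys : y s ∈ Icc (0 : ℝ) 1 := hy.mem_Icc hb hm hv h11 hs0'
  have hshift : SolvesOn (crossingField b m v) t (fun τ => y (τ + s)) :=
    ((hy.solvesOn (t + s)).shift hs0').mono (by linarith)
  have := hshift.eqOn hb hm hv (solvesOn_jointGF hb hX hX0 hm ⟨hys.1, hs1⟩ hv t)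
    (fun τ hτ => hy.mem_Icc hb hm hv h11 (add_nonneg hτ.1 hs0'))
    (fun τ _ => jointGF_mem_Icc hX hm.ne' hys hv τ) (by simpa using hs1)
    (by simp [jointGF_zero hX0]) ⟨ht, le_rfl⟩
  simp only at this
  rw [this]
  exact jointGF_mono hX hm.ne' hys h11 hys.2 hv t

/-- Here the equation coincides with that for v = 1, whose generating function at u = 1 is E[1] = 1,
a lower bound for y. The existence of an honest process thus excludes solutions that leave 1. -/
theorem IsSolution.eq_one (hb : IsBranchingRates b) (hX : IsMarkovBranchingProcess b μ X)
    (hX0 : ∀ᵐ ω ∂μ, X 0 ω = 1) (hm : 1 < m) (hv : v ∈ Icc (0 : ℝ) 1) (h0 : b m * (1 - v) = 0)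
    {y : ℝ → ℝ} (hy : IsSolution b m 1 v y) {t : ℝ} (ht : 0 ≤ t) : y t = 1 := by
  have h11 : (1 : ℝ) ∈ Icc (0 : ℝ) 1 := ⟨zero_le_one, le_rfl⟩
  have hy' : IsSolution b m 1 1 y :=
    ⟨hy.init, hy.summable, fun t ht => by simpa [h0] using hy.deriv t ht⟩
  refine le_antisymm (hy.mem_Icc hb hm hv h11 ht).2 ?_
  simpa [jointGF] using hy'.jointGF_le hb hX hX0 hm h11 ht

theorem IsSolution.eq_jointGF (hb : IsBranchingRates b) (hX : IsMarkovBranchingProcess b μ X)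
    (hX0 : ∀ᵐ ω ∂μ, X 0 ω = 1) (hm : 1 < m) (hu : u ∈ Icc (0 : ℝ) 1) (hv : v ∈ Icc (0 : ℝ) 1)
    {y : ℝ → ℝ} (hy : IsSolution b m u v y) {t : ℝ} (ht : 0 ≤ t) :
    y t = jointGF μ X m t u v := by
  rcases hu.2.lt_or_eq with hu1 | rfl
  · exact hy.eq_jointGF_of_lt_one hb hX hX0 hm ⟨hu.1, hu1⟩ hv ht
  · have hnn : 0 ≤ b m * (1 - v) := mul_nonneg (hb.nonneg m hm.ne') (sub_nonneg.2 hv.2)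
    rcases hnn.lt_or_eq with hpos | h0
    · exact le_antisymm (hy.le_jointGF hb hX hX0 hm hv hpos ht) (hy.jointGF_le hb hX hX0 hm hv ht)
    · rw [hy.eq_one hb hX hX0 hm hv h0.symm ht,
        (isSolution_jointGF_one hb hX hX0 hm hv).eq_one hb hX hX0 hm hv h0.symm ht]

theorem isSolution_jointGF (hb : IsBranchingRates b) (hX : IsMarkovBranchingProcess b μ X)
    (hX0 : ∀ᵐ ω ∂μ, X 0 ω = 1) (hm : 1 < m) (hu : u ∈ Icc (0 : ℝ) 1) (hv : v ∈ Icc (0 : ℝ) 1) :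
    IsSolution b m u v (fun t => jointGF μ X m t u v) := by
  rcases hu.2.lt_or_eq with hu1 | rfl
  · exact isSolution_jointGF_of_lt_one hb hX hX0 hm ⟨hu.1, hu1⟩ hv
  · exact isSolution_jointGF_one hb hX hX0 hm hv

end

end BranchingCrossing

theorem corollary3p2 (b : ℕ → ℝ) (hb : BranchingCrossing.IsBranchingRates b)
    {Ω : Type*} [MeasurableSpace Ω] (μ : Measure Ω) [IsProbabilityMeasure μ]
    (X : ℝ≥0 → Ω → ℕ) (hX : BranchingCrossing.IsMarkovBranchingProcess b μ X)
    (hX0 : ∀ᵐ ω ∂μ, X 0 ω = 1) (m : ℕ) (hm : 1 < m) :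
    ∃ G : ℝ → ℝ → ℝ → ℝ,
      (∀ u ∈ Icc (0 : ℝ) 1, ∀ v ∈ Icc (0 : ℝ) 1,
        BranchingCrossing.IsSolution b m u v (fun t => G t u v) ∧
        ∀ y : ℝ → ℝ, BranchingCrossing.IsSolution b m u v y →
          ∀ t, 0 ≤ t → y t = G t u v) ∧
      ∀ t : ℝ≥0, ∀ v ∈ Icc (0 : ℝ) 1,
        Integrable
          (fun ω => v ^ BranchingCrossing.crossingNumber (fun s => X s ω) m t) μ ∧
        ∫ ω, v ^ BranchingCrossing.crossingNumber (fun s => X s ω) m t ∂μ = G (t : ℝ) 1 v := by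
  refine ⟨BranchingCrossing.jointGF μ X m, fun u hu v hv =>
    ⟨BranchingCrossing.isSolution_jointGF hb hX hX0 hm hu hv,
      fun y hy t ht => hy.eq_jointGF hb hX hX0 hm hu hv ht⟩, fun t v hv => ⟨?_, ?_⟩⟩
  · simpa using BranchingCrossing.integrable_pow_mul_pow hX hm.ne' (u := 1)
      ⟨zero_le_one, le_rfl⟩ hv t
  · simp [BranchingCrossing.jointGF]
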